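/- Let $a,b\in\mathbb R$ and $\xi=a+ib$. "Smooth" means $C^\infty$ in $(x,t)\in\mathbb R^2$. Consider the NLS equation $iu_t+u_{xx}+2u|u|^2=0$ and its Lax pair $\phi_x=U\phi$, $\phi_t=V\phi$, $\phi=(\phi_1,\phi_2)^T$, with spectral parameter $\lambda\in\mathbb C$ and $$U=\begin{pmatrix}-i\lambda&u\\-\bar u&i\lambda\end{pmatrix},\qquad V=\begin{pmatrix}-2i\lambda^2+i|u|^2&2\lambda u+iu_x\\-2\lambda\bar u+i\bar u_x&2i\lambda^2-i|u|^2\end{pmatrix}.$$ For a vector $f=(f_1,f_2)^T\ne0$ and $\zeta\in\mathbb C$ put $$D_{\zeta,f}(\lambda)=(\lambda-\bar\zeta)I+\frac{\bar\zeta-\zeta}{|f_1|^2+|f_2|^2}\begin{pmatrix}|f_1|^2&f_1\bar f_2\\\bar f_1f_2&|f_2|^2\end{pmatrix}.$$ **(1) Darboux and Bäcklund transformation.** Let $\tilde u$ be a smooth solution of NLS on $\mathbb R^2$ and $f=(f_1,f_2)^T$ a smooth nowhere vanishing solution of the Lax pair with potential $\tilde u$ and $\lambda=\xi$. Put $$u=\tilde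 u-2i(\xi-\bar\xi)\frac{f_1\bar f_2}{|f_1|^2+|f_2|^2},\qquad \Omega=2b\,\frac{|f_1|^2-|f_2|^2}{|f_1|^2+|f_2|^2}.$$ Then $u$ is a smooth solution of NLS; if $\tilde\phi$ is a smooth solution of the Lax pair with potential $\tilde u$ and parameter $\lambda$, then $D_{\xi,f}(\lambda)\tilde\phi$ is one with potential $u$ and the same $\lambda$. The function $\Omega$ is a smooth real branch of $\sqrt{4b^2-|u-\tilde u|^2}$: $\Omega^2=4b^2-|u-\tilde u|^2$, and $\Omega$ is the nonnegative root where $b(|f_1|^2-|f_2|^2)\ge0$ and the nonpositive one where $b(|f_1|^2-|f_2|^2)\le0$. The Bäcklund transformation holds everywhere: $$u_x-\tilde u_x=-2ia(u-\tilde u)-(u+\tilde u)\Omega,$$ $$u_t-\tilde u_t=2a(u_x-\tilde u_x)-i\Omega(\tilde u_x+u_x)+i(u-\tilde u)(|u|^2+|\tilde u|^2).$$ If moreover $\tilde u(0,t)=0$ for all $t$, then $|u(0,t)|\le 2|b|$ and $u$ satisfies, for all $t$, the time-dependent boundary condition $$\Big(iu_t-2u_x\sqrt{4b^2-|u|^2}-4(a^2+b^2)u+2u|u|^2\Big)\Big|_{x=0}=0,\qquad(\ast)$$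 where $\sqrt{4b^2-|u|^2}$ is the branch $\Omega(0,t)$, that is, $+\sqrt{\ }$ at times with $b(|f_1|^2-|f_2|^2)(0,t)\ge0$ and $-\sqrt{\ }$ at times with $b(|f_1|^2-|f_2|^2)(0,t)\le0$. **(2) The $(N+1)$-soliton solution.** Let $N\ge0$ and let $\lambda_1,\lambda_3,\dots,\lambda_{2N-1}$, $c_1,\dots,c_N$, $d_1,\dots,d_N$ be complex numbers with $(c_j,d_j)\neq(0,0)$; put $\lambda_{2j}=-\lambda_{2j-1}$ and assume $\lambda_j\ne\lambda_k$, $\lambda_j\neq\bar\lambda_k$ for all $j\ne k$ in $\{1,\dots,2N\}$. For $k\in\{2j-1,2j\}$ put $\mu_k=c_je^{-i\lambda_kx-2i\lambda_k^2t}$ and $\nu_k=d_je^{i\lambda_kx+2i\lambda_k^2t}$. Let $\Delta_1[N]$ be the $4N\times4N$ determinant with rows $$(\lambda_1^{m}\nu_1,\dots,\lambda_{2N}^{m}\nu_{2N},\bar\lambda_1^{m}\bar\mu_1,\dots,\bar\lambda_{2N}^{m}\bar\mu_{2N}),\quad m=2N-1,\dots,0,$$ followed by $$(\lambda_1^{m}\mu_1,\dots,\lambda_{2N}^{m}\mu_{2N},-\bar\lambda_1^{m}\bar\nu_1,\dots,-\bar\lambda_{2N}^{m}\bar\nu_{2N}),\quad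 m=2N-1,\dots,0,$$ and $\Delta_2[N]$ the same determinant with the first row replaced by $(-\lambda_1^{2N}\mu_1,\dots,-\lambda_{2N}^{2N}\mu_{2N},\bar\lambda_1^{2N}\bar\nu_1,\dots,\bar\lambda_{2N}^{2N}\bar\nu_{2N})$. Put $\tilde u=2i\,\Delta_2[N]/\Delta_1[N]$ ($\tilde u=0$ if $N=0$). Define recursively $D_0(\lambda)=I$, $g_j=D_{j-1}(\lambda_j)(\mu_j,\nu_j)^T$, $D_j(\lambda)=D_{\lambda_j,g_j}(\lambda)D_{j-1}(\lambda)$ for $j=1,\dots,2N$, and for $A,B\in\mathbb C$ put $$\tilde\phi^{A,B}(\lambda)=D_{2N}(\lambda)\,(Ae^{-i\lambda x-2i\lambda^2t},\,Be^{i\lambda x+2i\lambda^2t})^T .$$ Then $\Delta_1[N]$ and all $g_j$ vanish nowhere, $\tilde u$ is a smooth solution of NLS with $\tilde u(0,t)=0$ for all $t$, and for all $A,B,\lambda$ the function $\tilde\phi^{A,B}(\lambda)$ is a smooth solution of the Lax pair with potential $\tilde u$ and parameter $\lambda$. Let further $(A,B)\ne(0,0)$ and $\xi\ne\lambda_k$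 for $k=1,\dots,2N$; if $\xi=\bar\lambda_{2j-1}$ or $\xi=\bar\lambda_{2j}$ for some $j$, assume also $A\bar c_j+B\bar d_j\ne0$. Then $f=\tilde\phi^{A,B}(\xi)$ vanishes nowhere, and the $(N+1)$-soliton solution $$u=2i\frac{\Delta_2[N]}{\Delta_1[N]}-2i(\xi-\bar\xi)\frac{f_1\bar f_2}{|f_1|^2+|f_2|^2}$$ is a smooth solution of NLS; for all $\lambda,A',B'$ the function $D_{\xi,f}(\lambda)\tilde\phi^{A',B'}(\lambda)$ is a smooth solution of its Lax pair with parameter $\lambda$; and with $\Omega=2b(|f_1|^2-|f_2|^2)/(|f_1|^2+|f_2|^2)$, the same smooth branch of $\sqrt{4b^2-|u-\tilde u|^2}$ as in (1), $u$ and $\tilde u$ satisfy the Bäcklund transformation of (1), and $u$ satisfies the boundary condition $(\ast)$ for all $t$, with the same choice of branch. **(3) The case $N=0$.** Let $A,B\ne0$, $\theta_1,\theta_2\in\mathbb R$, $e^{i\theta_1}=\frac{A\bar B}{|A||B|}$, $e^{\theta_2}=|A/B|$. Then, with $f=(Ae^{-i\xi x-2i\xi^2t},Be^{i\xi x+2i\xi^2t})^T$,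 the solution of (2) for $N=0$ is $$u=4b\frac{f_1\bar f_2}{|f_1|^2+|f_2|^2}=2b\,\frac{\exp\big(-2iax-4i(a^2-b^2)t+i\theta_1\big)}{\cosh(2bx+8abt+\theta_2)} .$$ -/

import Mathlib

open scoped ContDiff ComplexConjugate Matrix

noncomputable section

namespace NLSBoundary

/-- Partial derivative in the first (space) variable. -/
def dX {E : Type*} [NormedAddCommGroup E] [NormedSpace ℝ E] (u : ℝ → ℝ → E) (x t : ℝ) : E :=
  deriv (fun y => u y t) x

/-- Partial derivative in the second (time) variable. -/
def dT {E : Type*} [NormedAddCommGroup E] [NormedSpace ℝ E] (u : ℝ → ℝ → E) (x t : ℝ) : E :=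
  deriv (fun s => u x s) t

/-- `u` is jointly smooth in `(x, t)` on the whole plane. -/
def Smooth₂ {E : Type*} [NormedAddCommGroup E] [NormedSpace ℝ E] (u : ℝ → ℝ → E) : Prop :=
  ContDiff ℝ ∞ (fun p : ℝ × ℝ => u p.1 p.2)

/-- Smooth solutions of `i u_t + u_xx + 2 u |u|² = 0`. -/
def IsNLSSolution (u : ℝ → ℝ → ℂ) : Prop :=
  Smooth₂ u ∧
    ∀ x t, Complex.I * dT u x t + dX (dX u) x t + 2 * u x t * (‖u x t‖ : ℂ) ^ 2 = 0

/-- The space part `U` of the Lax pair with potential `u` and spectral parameter `l`. -/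
def laxU (u : ℝ → ℝ → ℂ) (l : ℂ) (x t : ℝ) : Matrix (Fin 2) (Fin 2) ℂ :=
  !![-Complex.I * l, u x t;
     -conj (u x t), Complex.I * l]

/-- The time part `V` of the Lax pair with potential `u` and spectral parameter `l`. -/
def laxV (u : ℝ → ℝ → ℂ) (l : ℂ) (x t : ℝ) : Matrix (Fin 2) (Fin 2) ℂ :=
  !![-2 * Complex.I * l ^ 2 + Complex.I * (‖u x t‖ : ℂ) ^ 2,
       2 * l * u x t + Complex.I * dX u x t;
     -2 * l * conj (u x t) + Complex.I * conj (dX u x t),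
       2 * Complex.I * l ^ 2 - Complex.I * (‖u x t‖ : ℂ) ^ 2]

/-- Smooth solutions of the Lax system `φ_x = U φ`, `φ_t = V φ`. -/
def IsLaxSolution (u : ℝ → ℝ → ℂ) (l : ℂ) (φ : ℝ → ℝ → Fin 2 → ℂ) : Prop :=
  Smooth₂ φ ∧
    ∀ x t, dX φ x t = laxU u l x t *ᵥ φ x t ∧ dT φ x t = laxV u l x t *ᵥ φ x t

/-- `|f₁|² + |f₂|²`. -/
def normSq₂ (f : Fin 2 → ℂ) : ℝ := ‖f 0‖ ^ 2 + ‖f 1‖ ^ 2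

/-- The Darboux matrix
`(l - ξ̄) I + (ξ̄ - ξ) / (|f₁|² + |f₂|²) * (|f₁|², f₁ f̄₂; f̄₁ f₂, |f₂|²)`. -/
def darbouxMatrix (ξ : ℂ) (f : Fin 2 → ℂ) (l : ℂ) : Matrix (Fin 2) (Fin 2) ℂ :=
  (l - conj ξ) • (1 : Matrix (Fin 2) (Fin 2) ℂ) +
    ((conj ξ - ξ) / (normSq₂ f : ℂ)) •
      !![(‖f 0‖ : ℂ) ^ 2, f 0 * conj (f 1);
         conj (f 0) * f 1, (‖f 1‖ : ℂ) ^ 2]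

/-- The Darboux-transformed potential
`u = ũ - 2 i (ξ - ξ̄) f₁ f̄₂ / (|f₁|² + |f₂|²)`. -/
def darbouxPotential (ξ : ℂ) (ut : ℝ → ℝ → ℂ) (f : ℝ → ℝ → Fin 2 → ℂ) (x t : ℝ) : ℂ :=
  ut x t - 2 * Complex.I * (ξ - conj ξ) *
    (f x t 0 * conj (f x t 1) / (normSq₂ (f x t) : ℂ))

/-- The real smooth branch `Ω = 2 b (|f₁|² - |f₂|²) / (|f₁|² + |f₂|²)` of
`√(4 b² - |u - ũ|²)` belonging to the Darboux transformation defined by `f`. -/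
def darbouxOmega (b : ℝ) (f : ℝ → ℝ → Fin 2 → ℂ) (x t : ℝ) : ℝ :=
  2 * b * (‖f x t 0‖ ^ 2 - ‖f x t 1‖ ^ 2) / normSq₂ (f x t)

/-- `Ω` is a determination of the square root `√(4 b² - |u - ũ|²)`: it is a smooth real function
and its value is `+√`, `-√` or `0` according to the sign of `b (|f₁|² - |f₂|²)`. -/
def IsRootBranch (b : ℝ) (u ut : ℝ → ℝ → ℂ) (f : ℝ → ℝ → Fin 2 → ℂ) (Ω : ℝ → ℝ → ℝ) : Prop :=
  Smooth₂ Ω ∧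
    ∀ x t, Ω x t ^ 2 = 4 * b ^ 2 - ‖u x t - ut x t‖ ^ 2 ∧
      Ω x t = Real.sign (b * (‖f x t 0‖ ^ 2 - ‖f x t 1‖ ^ 2)) *
        √(4 * b ^ 2 - ‖u x t - ut x t‖ ^ 2)

/-- The Bäcklund transformation between `u` and `ũ` (space part and time part), with
root function `Ω`. -/
def IsBacklundPair (a : ℝ) (u ut : ℝ → ℝ → ℂ) (Ω : ℝ → ℝ → ℝ) : Prop :=
  ∀ x t,
    dX u x t - dX ut x t
        = -2 * Complex.I * a * (u x t - ut x t) - (u x t + ut x t) * (Ω x t : ℂ) ∧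
    dT u x t - dT ut x t
        = 2 * a * (dX u x t - dX ut x t) - Complex.I * (Ω x t : ℂ) * (dX ut x t + dX u x t)
          + Complex.I * (u x t - ut x t) * ((‖u x t‖ : ℂ) ^ 2 + (‖ut x t‖ : ℂ) ^ 2)

/-- The Dirichlet condition at `x = 0`. -/
def IsDirichlet (u : ℝ → ℝ → ℂ) : Prop := ∀ t, u 0 t = 0

/-- The time-dependent boundary condition
`i u_t - 2 u_x r - 4 (a² + b²) u + 2 u |u|² = 0` at `x = 0` at time `t`, where the real number `r`
stands for the square root `√(4 b² - |u|²)`. -/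
def BoundaryConditionAt (a b : ℝ) (u : ℝ → ℝ → ℂ) (r t : ℝ) : Prop :=
  Complex.I * dT u 0 t - 2 * dX u 0 t * (r : ℂ) - 4 * ((a : ℂ) ^ 2 + (b : ℂ) ^ 2) * u 0 t
    + 2 * u 0 t * (‖u 0 t‖ : ℂ) ^ 2 = 0

/-- The time-dependent boundary condition for all times, with the determination of
`√(4 b² - |u|²)` at `x = 0` equal to `+√` or `-√` according to the sign of
`b (|f₁|² - |f₂|²)` at `(0, t)`. -/
def SatisfiesBoundaryCondition (a b : ℝ) (u : ℝ → ℝ → ℂ) (f : ℝ → ℝ → Fin 2 → ℂ) : Prop :=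
  ∀ t, ‖u 0 t‖ ^ 2 ≤ 4 * b ^ 2 ∧
    (0 ≤ b * (‖f 0 t 0‖ ^ 2 - ‖f 0 t 1‖ ^ 2) →
      BoundaryConditionAt a b u (√(4 * b ^ 2 - ‖u 0 t‖ ^ 2)) t) ∧
    (b * (‖f 0 t 0‖ ^ 2 - ‖f 0 t 1‖ ^ 2) ≤ 0 →
      BoundaryConditionAt a b u (-√(4 * b ^ 2 - ‖u 0 t‖ ^ 2)) t)

/-- The solution `(A e^{-i l x - 2 i l² t}, B e^{i l x + 2 i l² t})` of the Lax system with zero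
potential. -/
def freeLax (A B l : ℂ) (x t : ℝ) : Fin 2 → ℂ :=
  ![A * Complex.exp (-Complex.I * l * x - 2 * Complex.I * l ^ 2 * t),
    B * Complex.exp (Complex.I * l * x + 2 * Complex.I * l ^ 2 * t)]

/-- The paired spectral parameters `κ₀, -κ₀, κ₁, -κ₁, …` (numbered from `0`). -/
def lam (κ : ℕ → ℂ) (k : ℕ) : ℂ := if k % 2 = 0 then κ (k / 2) else -κ (k / 2)

/-- The pairs `(μ_k, ν_k)`, `k = 0, 1, …`; the constants `c_j, d_j` are shared by the indices
`2 j` and `2 j + 1`, whose spectral parameters are `κ_j` and `-κ_j`. -/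
def seed (κ c d : ℕ → ℂ) (k : ℕ) (x t : ℝ) : Fin 2 → ℂ :=
  freeLax (c (k / 2)) (d (k / 2)) (lam κ k) x t

/-- The matrix of `Δ₁[N]`: rows `inl i` are `λ^{2N-1-i} ν` resp. `λ̄^{2N-1-i} μ̄`, rows `inr i` are
`λ^{2N-1-i} μ` resp. `-λ̄^{2N-1-i} ν̄`. -/
def delta1Matrix (N : ℕ) (κ c d : ℕ → ℂ) (x t : ℝ) :
    Matrix (Fin (2 * N) ⊕ Fin (2 * N)) (Fin (2 * N) ⊕ Fin (2 * N)) ℂ :=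
  Matrix.of fun r s =>
    match r, s with
    | Sum.inl i, Sum.inl k => lam κ k ^ (2 * N - 1 - (i : ℕ)) * seed κ c d k x t 1
    | Sum.inl i, Sum.inr k => conj (lam κ k) ^ (2 * N - 1 - (i : ℕ)) * conj (seed κ c d k x t 0)
    | Sum.inr i, Sum.inl k => lam κ k ^ (2 * N - 1 - (i : ℕ)) * seed κ c d k x t 0
    | Sum.inr i, Sum.inr k => -(conj (lam κ k) ^ (2 * N - 1 - (i : ℕ)) * conj (seed κ c d k x t 1))

/-- The matrix of `Δ₂[N]`: that of `Δ₁[N]` with its first row replaced by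
`(-λ^{2N} μ, λ̄^{2N} ν̄)`. -/
def delta2Matrix (N : ℕ) (κ c d : ℕ → ℂ) (x t : ℝ) :
    Matrix (Fin (2 * N) ⊕ Fin (2 * N)) (Fin (2 * N) ⊕ Fin (2 * N)) ℂ :=
  Matrix.of fun r s =>
    match r, s with
    | Sum.inl i, Sum.inl k =>
        if (i : ℕ) = 0 then -(lam κ k ^ (2 * N) * seed κ c d k x t 0)
        else delta1Matrix N κ c d x t r s
    | Sum.inl i, Sum.inr k =>
        if (i : ℕ) = 0 then conj (lam κ k) ^ (2 * N) * conj (seed κ c d k x t 1)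
        else delta1Matrix N κ c d x t r s
    | Sum.inr _, _ => delta1Matrix N κ c d x t r s

/-- The `N`-soliton potential `ũ = 2 i Δ₂[N] / Δ₁[N]` (the zero potential for `N = 0`, where the
determinants are empty). -/
def solitonPotential (N : ℕ) (κ c d : ℕ → ℂ) (x t : ℝ) : ℂ :=
  if N = 0 then 0
  else 2 * Complex.I * ((delta2Matrix N κ c d x t).det / (delta1Matrix N κ c d x t).det)

/-- The product of the first `m` Darboux matrices (the latest one leftmost), at the spectral
parameter `l`; the vector that defines the `m`-th factor is the `m`-th seed transformed by the
product of the preceding factors at `l = λ_m`. -/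
def chain (κ c d : ℕ → ℂ) : ℕ → ℂ → ℝ → ℝ → Matrix (Fin 2) (Fin 2) ℂ
  | 0, _, _, _ => 1
  | m + 1, l, x, t =>
      darbouxMatrix (lam κ m) (chain κ c d m (lam κ m) x t *ᵥ seed κ c d m x t) l
        * chain κ c d m l x t

/-- The vector `(μ_m[m-1], ν_m[m-1])` that defines the `m`-th factor of the chain. -/
def chainVec (κ c d : ℕ → ℂ) (m : ℕ) (x t : ℝ) : Fin 2 → ℂ :=
  chain κ c d m (lam κ m) x t *ᵥ seed κ c d m x t

/-- The solution `φ̃[N] = D[N] φ̃[0]` of the Lax system with the `N`-soliton potential. -/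
def solitonLax (N : ℕ) (κ c d : ℕ → ℂ) (A B l : ℂ) (x t : ℝ) : Fin 2 → ℂ :=
  chain κ c d (2 * N) l x t *ᵥ freeLax A B l x t

/-- The explicit `(N+1)`-soliton potential
`2 i Δ₂[N]/Δ₁[N] - 2 i (ξ - ξ̄) φ̃₁[N] conj(φ̃₂[N]) / (|φ̃₁[N]|² + |φ̃₂[N]|²)` at `l = ξ`. -/
def boundarySoliton (N : ℕ) (κ c d : ℕ → ℂ) (A B ξ : ℂ) (x t : ℝ) : ℂ :=
  darbouxPotential ξ (solitonPotential N κ c d) (solitonLax N κ c d A B ξ) x t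

/-- Admissible soliton data: the `2N` spectral parameters are distinct, none is the conjugate of
another one, and no pair `(c_j, d_j)` vanishes. Only the first `N` entries matter. -/
def AdmissibleData (N : ℕ) (κ c d : ℕ → ℂ) : Prop :=
  (∀ j < 2 * N, ∀ k < 2 * N, j ≠ k → lam κ j ≠ lam κ k ∧ lam κ j ≠ conj (lam κ k)) ∧
    ∀ j < N, c j ≠ 0 ∨ d j ≠ 0

end NLSBoundary

end

noncomputable section

namespace NLSBoundary

/-! One Darboux step. Put q = u - ũ. The Darboux matrix at ξ = a + ib equals (λ - a)I - (i/2)[[Ω,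
q], [q̄, -Ω]] with Ω² + |q|² = 4b², so `f` enters only through q and Ω. The Lax equations of `f`
give closed formulas for the derivatives of q and Ω: those of q are the Bäcklund transformation, and
Ω_x = |u|² - |ũ|². NLS for u, the new Lax pair and (∗) then become polynomial identities in q, q̄,
Ω, ũ and derivatives of ũ.

Solitons. The chain of 2N Darboux matrices is a monic matrix polynomial of degree 2N in λ. It kills
the k-th seed at λ_k and the orthogonal vector at the conjugate of λ_k. The key is uniqueness
(`AnnihilatesSeeds.eq_zero`): a row of polynomials of degree < 2N with these 4N zeros can be divided
on the right by each Darboux factor, losing a degree each time, so it is zero. Three facts follow.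
Δ₁ ≠ 0, because a left null vector would be the coefficient vector of such a row. Cramer's rule
identifies 2iΔ₂/Δ₁ with the potential of the chain, which is 2i times a subleading coefficient. At x
= 0 the seeds of λ and -λ coincide, so by uniqueness the lower-order part of the first row is even
in λ, and that coefficient, of odd degree 2N - 1, vanishes.

The vectors defining the factors do not vanish because the determinant of the chain is ∏(λ - λ_k)(λ
- λ̄_k). If ξ is a conjugate λ̄_k, this determinant is zero and a Hermitian pairing, constant in (x,
t), decides instead. -/

theorem Smooth₂.differentiableAt_left {E : Type*} [NormedAddCommGroup E] [NormedSpace ℝ E]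
    {u : ℝ → ℝ → E} (hu : Smooth₂ u) (x t : ℝ) : DifferentiableAt ℝ (fun y => u y t) x := by
  have h : ContDiff ℝ ∞ (fun y : ℝ => u y t) :=
    ContDiff.comp (g := fun p : ℝ × ℝ => u p.1 p.2) hu (contDiff_id.prodMk contDiff_const)
  exact h.differentiable (by simp) x

theorem Smooth₂.differentiableAt_right {E : Type*} [NormedAddCommGroup E] [NormedSpace ℝ E]
    {u : ℝ → ℝ → E} (hu : Smooth₂ u) (x t : ℝ) : DifferentiableAt ℝ (fun s => u x s) t := by
  have h : ContDiff ℝ ∞ (fun s : ℝ => u x s) :=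
    ContDiff.comp (g := fun p : ℝ × ℝ => u p.1 p.2) hu (contDiff_const.prodMk contDiff_id)
  exact h.differentiable (by simp) t

theorem Smooth₂.hasDerivAt_left {E : Type*} [NormedAddCommGroup E] [NormedSpace ℝ E]
    {u : ℝ → ℝ → E} (hu : Smooth₂ u) (x t : ℝ) : HasDerivAt (fun y => u y t) (dX u x t) x :=
  (hu.differentiableAt_left x t).hasDerivAt

theorem Smooth₂.hasDerivAt_right {E : Type*} [NormedAddCommGroup E] [NormedSpace ℝ E]
    {u : ℝ → ℝ → E} (hu : Smooth₂ u) (x t : ℝ) : HasDerivAt (fun s => u x s) (dT u x t) t :=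
  (hu.differentiableAt_right x t).hasDerivAt

theorem Smooth₂.hasDerivAt_dX {E : Type*} [NormedAddCommGroup E] [NormedSpace ℝ E]
    {u : ℝ → ℝ → E} (hu : Smooth₂ u) (x t : ℝ) :
    HasDerivAt (fun y => dX u y t) (dX (dX u) x t) x := by
  have h : ContDiff ℝ ∞ (fun y : ℝ => u y t) :=
    ContDiff.comp (g := fun p : ℝ × ℝ => u p.1 p.2) hu (contDiff_id.prodMk contDiff_const)
  have h' := (contDiff_infty_iff_deriv.1 h).2
  exact ((h'.differentiable (by simp)) x).hasDerivAt

theorem Smooth₂.apply {f : ℝ → ℝ → Fin 2 → ℂ} (hf : Smooth₂ f) (i : Fin 2) :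
    Smooth₂ (fun x t => f x t i) :=
  contDiff_pi.1 hf i

theorem Smooth₂.conj {u : ℝ → ℝ → ℂ} (hu : Smooth₂ u) : Smooth₂ (fun x t => conj (u x t)) :=
  Complex.conjCLE.contDiff.comp hu

theorem hasDerivAt_conj {u : ℝ → ℂ} {u' : ℂ} {x : ℝ} (h : HasDerivAt u u' x) :
    HasDerivAt (fun y => conj (u y)) (conj u') x :=
  Complex.conjCLE.toContinuousLinearMap.hasFDerivAt.comp_hasDerivAt x h

/-- The Lax system in components. -/
theorem isLaxSolution_iff {u : ℝ → ℝ → ℂ} {l : ℂ} {φ : ℝ → ℝ → Fin 2 → ℂ} :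
    IsLaxSolution u l φ ↔ Smooth₂ φ ∧ ∀ x t,
      HasDerivAt (fun y => φ y t 0) (-Complex.I * l * φ x t 0 + u x t * φ x t 1) x ∧
      HasDerivAt (fun y => φ y t 1) (-conj (u x t) * φ x t 0 + Complex.I * l * φ x t 1) x ∧
      HasDerivAt (fun s => φ x s 0)
        ((-2 * Complex.I * l ^ 2 + Complex.I * (u x t * conj (u x t))) * φ x t 0 +
          (2 * l * u x t + Complex.I * dX u x t) * φ x t 1) t ∧
      HasDerivAt (fun s => φ x s 1)
        ((-2 * l * conj (u x t) + Complex.I * conj (dX u x t)) * φ x t 0 +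
          (2 * Complex.I * l ^ 2 - Complex.I * (u x t * conj (u x t))) * φ x t 1) t := by
  refine and_congr_right fun hs => forall_congr' fun x => forall_congr' fun t => ?_
  have hx := hasDerivAt_pi.1 (hs.hasDerivAt_left x t)
  have ht := hasDerivAt_pi.1 (hs.hasDerivAt_right x t)
  rw [Complex.mul_conj']
  constructor
  · rintro ⟨h1, h2⟩
    refine ⟨?_, ?_, ?_, ?_⟩
    · simpa [h1, laxU, Matrix.mulVec, dotProduct, Fin.sum_univ_two] using hx 0
    · simpa [h1, laxU, Matrix.mulVec, dotProduct, Fin.sum_univ_two] using hx 1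
    · simpa [h2, laxV, Matrix.mulVec, dotProduct, Fin.sum_univ_two] using ht 0
    · simpa [h2, laxV, Matrix.mulVec, dotProduct, Fin.sum_univ_two] using ht 1
  · rintro ⟨h1, h2, h3, h4⟩
    constructor <;> ext i <;> fin_cases i
    · simpa [laxU, Matrix.mulVec, dotProduct, Fin.sum_univ_two] using (hx 0).unique h1
    · simpa [laxU, Matrix.mulVec, dotProduct, Fin.sum_univ_two] using (hx 1).unique h2
    · simpa [laxV, Matrix.mulVec, dotProduct, Fin.sum_univ_two] using (ht 0).unique h3
    · simpa [laxV, Matrix.mulVec, dotProduct, Fin.sum_univ_two] using (ht 1).unique h4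

/-- The difference `u - ũ` of the two potentials of a Darboux transformation. -/
def darbouxDiff (b : ℝ) (f : ℝ → ℝ → Fin 2 → ℂ) (x t : ℝ) : ℂ :=
  4 * b * (f x t 0 * conj (f x t 1)) / (f x t 0 * conj (f x t 0) + f x t 1 * conj (f x t 1))

theorem ofReal_normSq₂ (g : Fin 2 → ℂ) :
    (normSq₂ g : ℂ) = g 0 * conj (g 0) + g 1 * conj (g 1) := by
  simp [normSq₂, Complex.mul_conj']

theorem normSq₂_pos {g : Fin 2 → ℂ} (hg : g ≠ 0) : 0 < normSq₂ g := by
  have : g 0 ≠ 0 ∨ g 1 ≠ 0 := by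
    by_contra! h
    exact hg (by ext i; fin_cases i <;> simp [h])
  unfold normSq₂
  rcases this with h | h <;> have := norm_pos_iff.2 h <;> positivity

theorem mul_conj_add_ne_zero {g : Fin 2 → ℂ} (hg : g ≠ 0) :
    g 0 * conj (g 0) + g 1 * conj (g 1) ≠ 0 := by
  rw [← ofReal_normSq₂]
  exact_mod_cast (normSq₂_pos hg).ne'

theorem ofReal_darbouxOmega (b : ℝ) (f : ℝ → ℝ → Fin 2 → ℂ) (x t : ℝ) :
    (darbouxOmega b f x t : ℂ) =
      2 * b * (f x t 0 * conj (f x t 0) - f x t 1 * conj (f x t 1)) /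
        (f x t 0 * conj (f x t 0) + f x t 1 * conj (f x t 1)) := by
  rw [← ofReal_normSq₂]
  simp [darbouxOmega, Complex.mul_conj']

/-! ### The Darboux matrix expressed through q = u - ũ and Ω -/

section Step

variable {a b : ℝ} {ξ : ℂ}

theorem sub_conj_of_eq (hξ : ξ = (a : ℂ) + Complex.I * (b : ℂ)) :
    ξ - conj ξ = 2 * Complex.I * b := by
  subst hξ; simp; ring

theorem darbouxPotential_eq (hξ : ξ = (a : ℂ) + Complex.I * (b : ℂ)) (ut : ℝ → ℝ → ℂ)
    (f : ℝ → ℝ → Fin 2 → ℂ) (x t : ℝ) :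
    darbouxPotential ξ ut f x t = ut x t + darbouxDiff b f x t := by
  rw [darbouxPotential, sub_conj_of_eq hξ, ofReal_normSq₂, darbouxDiff]
  linear_combination (-4 * (b : ℂ) * (f x t 0 * conj (f x t 1) /
    (f x t 0 * conj (f x t 0) + f x t 1 * conj (f x t 1)))) * Complex.I_sq

/-- Splitting the rank-one projection onto `f` into half the identity and a traceless part turns λ -
ξ̄ into λ - a and leaves a matrix in q and Ω alone. -/
theorem darbouxMatrix_mulVec (hξ : ξ = (a : ℂ) + Complex.I * (b : ℂ)) {f : ℝ → ℝ → Fin 2 → ℂ}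
    {x t : ℝ} (hf : f x t ≠ 0) (l : ℂ) (v : Fin 2 → ℂ) :
    darbouxMatrix ξ (f x t) l *ᵥ v =
      ![(l - a) * v 0 - Complex.I / 2 *
          (darbouxOmega b f x t * v 0 + darbouxDiff b f x t * v 1),
        (l - a) * v 1 - Complex.I / 2 *
          (conj (darbouxDiff b f x t) * v 0 - darbouxOmega b f x t * v 1)] := by
  have hn := mul_conj_add_ne_zero hf
  have hn' : conj (f x t 0) * (f x t 0) + conj (f x t 1) * f x t 1 ≠ 0 := by
    convert hn using 1; ring
  have e : conj ξ - ξ = -(2 * Complex.I * b) := by rw [← sub_conj_of_eq hξ]; ring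
  have e' : conj ξ = a - Complex.I * b := by subst hξ; simp; ring
  ext i
  fin_cases i
  · simp [darbouxMatrix, Matrix.mulVec, dotProduct, Fin.sum_univ_two, ofReal_darbouxOmega,
      darbouxDiff, ofReal_normSq₂, e, ← Complex.mul_conj']
    rw [e']
    field_simp
    ring
  · simp [darbouxMatrix, Matrix.mulVec, dotProduct, Fin.sum_univ_two, ofReal_darbouxOmega,
      darbouxDiff, ofReal_normSq₂, e, ← Complex.mul_conj']
    rw [e', Complex.conj_ofNat]
    field_simp
    ring

end Step

/-! ### First-order equations for q and Ω -/

section Step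

variable {a b : ℝ} {ξ : ℂ} {ut : ℝ → ℝ → ℂ} {f : ℝ → ℝ → Fin 2 → ℂ}

theorem conj_eq_of_eq (hξ : ξ = (a : ℂ) + Complex.I * (b : ℂ)) :
    conj ξ = a - Complex.I * b := by
  subst hξ; simp; ring

theorem conj_darbouxDiff (x t : ℝ) : conj (darbouxDiff b f x t) =
    4 * b * (conj (f x t 0) * f x t 1) /
      (f x t 0 * conj (f x t 0) + f x t 1 * conj (f x t 1)) := by
  simp only [darbouxDiff, map_div₀, map_mul, map_add, Complex.conj_conj, Complex.conj_ofReal,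
    Complex.conj_ofNat]
  rw [mul_comm (conj (f x t 0)) (f x t 0), mul_comm (conj (f x t 1)) (f x t 1)]

theorem darbouxOmega_sq_add {x t : ℝ} (hf : f x t ≠ 0) :
    (darbouxOmega b f x t : ℂ) ^ 2 + darbouxDiff b f x t * conj (darbouxDiff b f x t)
      = 4 * b ^ 2 := by
  have hn := mul_conj_add_ne_zero hf
  rw [ofReal_darbouxOmega, conj_darbouxDiff, darbouxDiff]
  field_simp
  ring

/-- Derivative of a quotient of the form occurring in `darbouxDiff`. -/
theorem hasDerivAt_darbouxDiff_aux {g h : ℝ → ℂ} {g' h' : ℂ} {x : ℝ} (b : ℝ)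
    (hg : HasDerivAt g g' x) (hh : HasDerivAt h h' x)
    (hn : g x * conj (g x) + h x * conj (h x) ≠ 0) :
    HasDerivAt (fun y => 4 * (b : ℂ) * (g y * conj (h y)) /
        (g y * conj (g y) + h y * conj (h y)))
      ((4 * b * (g' * conj (h x) + g x * conj h') * (g x * conj (g x) + h x * conj (h x)) -
        4 * b * (g x * conj (h x)) *
          (g' * conj (g x) + g x * conj g' + (h' * conj (h x) + h x * conj h'))) /
        (g x * conj (g x) + h x * conj (h x)) ^ 2) x :=
  ((hg.mul (hasDerivAt_conj hh)).const_mul _).div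
    ((hg.mul (hasDerivAt_conj hg)).add (hh.mul (hasDerivAt_conj hh))) hn

/-- Derivative of a quotient of the form occurring in `darbouxOmega`. -/
theorem hasDerivAt_darbouxOmega_aux {g h : ℝ → ℂ} {g' h' : ℂ} {x : ℝ} (b : ℝ)
    (hg : HasDerivAt g g' x) (hh : HasDerivAt h h' x)
    (hn : g x * conj (g x) + h x * conj (h x) ≠ 0) :
    HasDerivAt (fun y => 2 * (b : ℂ) * (g y * conj (g y) - h y * conj (h y)) /
        (g y * conj (g y) + h y * conj (h y)))
      ((2 * b * (g' * conj (g x) + g x * conj g' - (h' * conj (h x) + h x * conj h')) *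
          (g x * conj (g x) + h x * conj (h x)) -
        2 * b * (g x * conj (g x) - h x * conj (h x)) *
          (g' * conj (g x) + g x * conj g' + (h' * conj (h x) + h x * conj h'))) /
        (g x * conj (g x) + h x * conj (h x)) ^ 2) x :=
  (((hg.mul (hasDerivAt_conj hg)).sub (hh.mul (hasDerivAt_conj hh))).const_mul _).div
    ((hg.mul (hasDerivAt_conj hg)).add (hh.mul (hasDerivAt_conj hh))) hn

theorem hasDerivAt_darbouxDiff_left (hξ : ξ = (a : ℂ) + Complex.I * (b : ℂ))
    (hL : IsLaxSolution ut ξ f) (x t : ℝ) (hf : f x t ≠ 0) :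
    HasDerivAt (fun y => darbouxDiff b f y t)
      (-2 * Complex.I * a * darbouxDiff b f x t -
        (2 * ut x t + darbouxDiff b f x t) * darbouxOmega b f x t) x := by
  obtain ⟨h0, h1, -, -⟩ := (isLaxSolution_iff.1 hL).2 x t
  have hn := mul_conj_add_ne_zero hf
  refine (hasDerivAt_darbouxDiff_aux b h0 h1 hn).congr_deriv ?_
  symm
  have hI := Complex.I_sq
  simp only [map_add, map_mul, map_neg, Complex.conj_conj, Complex.conj_I, conj_eq_of_eq hξ]
  rw [ofReal_darbouxOmega, darbouxDiff, hξ]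
  field_simp
  -- Conjugates become independent variables; what is left is a polynomial identity modulo i² = -1.
  generalize conj (f x t 0) = c0 at *
  generalize conj (f x t 1) = c1 at *
  generalize conj (ut x t) = v at *
  grind

/-- The right-hand side is |u|² - |ũ|², written out in q and ũ. -/
theorem hasDerivAt_darbouxOmega_left (hξ : ξ = (a : ℂ) + Complex.I * (b : ℂ))
    (hL : IsLaxSolution ut ξ f) (x t : ℝ) (hf : f x t ≠ 0) :
    HasDerivAt (fun y => (darbouxOmega b f y t : ℂ))
      (darbouxDiff b f x t * conj (darbouxDiff b f x t) + ut x t * conj (darbouxDiff b f x t) +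
        conj (ut x t) * darbouxDiff b f x t) x := by
  obtain ⟨h0, h1, -, -⟩ := (isLaxSolution_iff.1 hL).2 x t
  have hn := mul_conj_add_ne_zero hf
  simp only [ofReal_darbouxOmega]
  refine (hasDerivAt_darbouxOmega_aux b h0 h1 hn).congr_deriv ?_
  symm
  have hI := Complex.I_sq
  simp only [map_add, map_mul, map_neg, Complex.conj_conj, Complex.conj_I, conj_eq_of_eq hξ]
  rw [conj_darbouxDiff, darbouxDiff, hξ]
  field_simp
  generalize conj (f x t 0) = c0 at *
  generalize conj (f x t 1) = c1 at *
  generalize conj (ut x t) = v at *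
  grind

theorem hasDerivAt_darbouxDiff_right (hξ : ξ = (a : ℂ) + Complex.I * (b : ℂ))
    (hL : IsLaxSolution ut ξ f) (x t : ℝ) (hf : f x t ≠ 0) :
    HasDerivAt (fun s => darbouxDiff b f x s)
      (2 * a * (-2 * Complex.I * a * darbouxDiff b f x t -
          (2 * ut x t + darbouxDiff b f x t) * darbouxOmega b f x t) -
        Complex.I * darbouxOmega b f x t * (2 * dX ut x t +
          (-2 * Complex.I * a * darbouxDiff b f x t -
            (2 * ut x t + darbouxDiff b f x t) * darbouxOmega b f x t)) +
        Complex.I * darbouxDiff b f x t *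
          ((ut x t + darbouxDiff b f x t) * (conj (ut x t) + conj (darbouxDiff b f x t)) +
            ut x t * conj (ut x t))) t := by
  obtain ⟨-, -, h0, h1⟩ := (isLaxSolution_iff.1 hL).2 x t
  have hn := mul_conj_add_ne_zero hf
  refine (hasDerivAt_darbouxDiff_aux b h0 h1 hn).congr_deriv ?_
  symm
  have hI := Complex.I_sq
  simp only [map_add, map_sub, map_mul, map_neg, map_pow, Complex.conj_conj, Complex.conj_I,
    Complex.conj_ofNat, conj_eq_of_eq hξ]
  rw [ofReal_darbouxOmega, conj_darbouxDiff, darbouxDiff, hξ]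
  clear h0 h1 hf hL hξ
  generalize conj (f x t 0) = c0 at *
  generalize conj (f x t 1) = c1 at *
  generalize f x t 0 = g0 at *
  generalize f x t 1 = g1 at *
  generalize conj (ut x t) = v at *
  generalize conj (dX ut x t) = v' at *
  have hn' : g0 * c0 + c1 * g1 ≠ 0 := by rwa [mul_comm c1]
  field_simp
  clear hn hn'
  grind

/-- The right-hand side is i(u_x ū - ū_x u) minus the same expression in ũ, with u_x replaced by its
Bäcklund value. It is the difference of the fluxes of |u|² and |ũ|², matching Ω_x = |u|² - |ũ|². -/
theorem hasDerivAt_darbouxOmega_right (hξ : ξ = (a : ℂ) + Complex.I * (b : ℂ))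
    (hL : IsLaxSolution ut ξ f) (x t : ℝ) (hf : f x t ≠ 0) :
    HasDerivAt (fun s => (darbouxOmega b f x s : ℂ))
      (Complex.I * ((dX ut x t + (-2 * Complex.I * a * darbouxDiff b f x t -
            (2 * ut x t + darbouxDiff b f x t) * darbouxOmega b f x t)) *
            (conj (ut x t) + conj (darbouxDiff b f x t)) -
          (conj (dX ut x t) + (2 * Complex.I * a * conj (darbouxDiff b f x t) -
            (2 * conj (ut x t) + conj (darbouxDiff b f x t)) * darbouxOmega b f x t)) *
            (ut x t + darbouxDiff b f x t) -
          dX ut x t * conj (ut x t) + conj (dX ut x t) * ut x t)) t := by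
  obtain ⟨-, -, h0, h1⟩ := (isLaxSolution_iff.1 hL).2 x t
  have hn := mul_conj_add_ne_zero hf
  simp only [ofReal_darbouxOmega]
  refine (hasDerivAt_darbouxOmega_aux b h0 h1 hn).congr_deriv ?_
  symm
  have hI := Complex.I_sq
  simp only [map_add, map_sub, map_mul, map_neg, map_pow, Complex.conj_conj, Complex.conj_I,
    Complex.conj_ofNat, conj_eq_of_eq hξ]
  rw [conj_darbouxDiff, darbouxDiff, hξ]
  clear h0 h1 hf hL hξ
  generalize conj (f x t 0) = c0 at *
  generalize conj (f x t 1) = c1 at *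
  generalize f x t 0 = g0 at *
  generalize f x t 1 = g1 at *
  generalize conj (ut x t) = v at *
  generalize conj (dX ut x t) = v' at *
  have hn' : g0 * c0 + c1 * g1 ≠ 0 := by rwa [mul_comm c1]
  field_simp
  clear hn hn'
  grind

end Step

/-! ### One Darboux step: Bäcklund transformation, NLS, Lax pair, boundary condition -/

section Step

variable {a b : ℝ} {ξ : ℂ} {ut : ℝ → ℝ → ℂ} {f : ℝ → ℝ → Fin 2 → ℂ}

theorem Smooth₂.darbouxDiff (b : ℝ) (hs : Smooth₂ f) (hf : ∀ x t, f x t ≠ 0) :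
    Smooth₂ (darbouxDiff b f) := by
  have h0 := hs.apply 0
  have h1 := hs.apply 1
  have h0' := h0.conj
  have h1' := h1.conj
  unfold Smooth₂ at *
  exact (contDiff_const.mul (h0.mul h1')).mul (((h0.mul h0').add (h1.mul h1')).inv
    fun p : ℝ × ℝ => mul_conj_add_ne_zero (hf p.1 p.2))

theorem Smooth₂.ofReal_darbouxOmega (b : ℝ) (hs : Smooth₂ f) (hf : ∀ x t, f x t ≠ 0) :
    Smooth₂ (fun x t => (darbouxOmega b f x t : ℂ)) := by
  have h0 := hs.apply 0
  have h1 := hs.apply 1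
  have h0' := h0.conj
  have h1' := h1.conj
  simp only [NLSBoundary.ofReal_darbouxOmega, div_eq_mul_inv]
  unfold Smooth₂ at *
  exact (contDiff_const.mul ((h0.mul h0').sub (h1.mul h1'))).mul
    (((h0.mul h0').add (h1.mul h1')).inv fun p : ℝ × ℝ => mul_conj_add_ne_zero (hf p.1 p.2))

theorem Smooth₂.darbouxOmega (b : ℝ) (hs : Smooth₂ f) (hf : ∀ x t, f x t ≠ 0) :
    Smooth₂ (darbouxOmega b f) := by
  have h := hs.ofReal_darbouxOmega b hf
  unfold Smooth₂ at *
  exact Complex.reCLM.contDiff.comp h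

theorem Smooth₂.darbouxPotential (hξ : ξ = (a : ℂ) + Complex.I * (b : ℂ)) (hut : Smooth₂ ut)
    (hs : Smooth₂ f) (hf : ∀ x t, f x t ≠ 0) : Smooth₂ (darbouxPotential ξ ut f) := by
  have h := hs.darbouxDiff b hf
  have e : NLSBoundary.darbouxPotential ξ ut f = fun x t => ut x t + NLSBoundary.darbouxDiff b f x t :=
    funext₂ (darbouxPotential_eq hξ ut f)
  rw [e]
  unfold Smooth₂ at *
  exact hut.add h

theorem hasDerivAt_darbouxPotential_left (hξ : ξ = (a : ℂ) + Complex.I * (b : ℂ))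
    (hut : Smooth₂ ut) (hL : IsLaxSolution ut ξ f) (hf : ∀ x t, f x t ≠ 0) (x t : ℝ) :
    HasDerivAt (fun y => darbouxPotential ξ ut f y t)
      (dX ut x t + (-2 * Complex.I * a * darbouxDiff b f x t -
        (2 * ut x t + darbouxDiff b f x t) * darbouxOmega b f x t)) x := by
  simp only [darbouxPotential_eq hξ]
  exact (hut.hasDerivAt_left x t).add (hasDerivAt_darbouxDiff_left hξ hL x t (hf x t))

theorem dX_darbouxPotential (hξ : ξ = (a : ℂ) + Complex.I * (b : ℂ))
    (hut : Smooth₂ ut) (hL : IsLaxSolution ut ξ f) (hf : ∀ x t, f x t ≠ 0) (x t : ℝ) :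
    dX (darbouxPotential ξ ut f) x t =
      dX ut x t + (-2 * Complex.I * a * darbouxDiff b f x t -
        (2 * ut x t + darbouxDiff b f x t) * darbouxOmega b f x t) :=
  (hasDerivAt_darbouxPotential_left hξ hut hL hf x t).deriv

theorem isBacklundPair_darbouxPotential (hξ : ξ = (a : ℂ) + Complex.I * (b : ℂ))
    (hut : Smooth₂ ut) (hL : IsLaxSolution ut ξ f) (hf : ∀ x t, f x t ≠ 0) :
    IsBacklundPair a (darbouxPotential ξ ut f) ut (darbouxOmega b f) := by
  intro x t
  have ht : dT (darbouxPotential ξ ut f) x t = _ := HasDerivAt.deriv (by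
    simp only [darbouxPotential_eq hξ]
    exact (hut.hasDerivAt_right x t).add (hasDerivAt_darbouxDiff_right hξ hL x t (hf x t)))
  rw [ht, dX_darbouxPotential hξ hut hL hf, ← Complex.mul_conj', ← Complex.mul_conj',
    darbouxPotential_eq hξ, map_add]
  constructor <;> ring

/-- Differentiating the space part in x and adding i times the time part cancels all first
derivatives. There remains iq_t + q_xx = -q(|u|² + |ũ|²) - (u + ũ)Ω_x, and Ω_x = |u|² - |ũ|² makes
this -2u|u|² + 2ũ|ũ|². -/
theorem isNLSSolution_darbouxPotential (hξ : ξ = (a : ℂ) + Complex.I * (b : ℂ))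
    (hut : IsNLSSolution ut) (hL : IsLaxSolution ut ξ f) (hf : ∀ x t, f x t ≠ 0) :
    IsNLSSolution (darbouxPotential ξ ut f) := by
  refine ⟨hut.1.darbouxPotential hξ hL.1 hf, fun x t => ?_⟩
  have hq := hasDerivAt_darbouxDiff_left hξ hL x t (hf x t)
  have hxx : dX (dX (darbouxPotential ξ ut f)) x t = _ := HasDerivAt.deriv (by
    simp only [dX_darbouxPotential hξ hut.1 hL hf]
    exact (hut.1.hasDerivAt_dX x t).add ((hq.const_mul _).sub
      ((((hut.1.hasDerivAt_left x t).const_mul 2).add hq).mul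
        (hasDerivAt_darbouxOmega_left hξ hL x t (hf x t)))))
  have hN := hut.2 x t
  have hB := (isBacklundPair_darbouxPotential hξ hut.1 hL hf x t).2
  rw [dX_darbouxPotential hξ hut.1 hL hf] at hB
  rw [hxx]
  simp only [Pi.add_apply]
  rw [← Complex.mul_conj'] at hN
  rw [← Complex.mul_conj', ← Complex.mul_conj'] at hB
  rw [← Complex.mul_conj']
  rw [darbouxPotential_eq hξ, map_add] at *
  generalize dT (darbouxPotential ξ ut f) x t = T at *
  generalize darbouxDiff b f x t = q at *
  generalize (darbouxOmega b f x t : ℂ) = w at *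
  generalize dT ut x t = T' at *
  generalize dX ut x t = v' at *
  generalize conj q = q' at *
  generalize conj (ut x t) = z' at *
  generalize ut x t = z at *
  have hI := Complex.I_sq
  clear hxx hL hf hq hut
  grind

/-- These are the gauge equations D_x + DŨ = UD and D_t + DṼ = VD applied to `φ`, checked entry by
entry after inserting the derivatives of q and Ω. -/
theorem isLaxSolution_darbouxMatrix_mulVec (hξ : ξ = (a : ℂ) + Complex.I * (b : ℂ))
    (hut : IsNLSSolution ut) (hL : IsLaxSolution ut ξ f) (hf : ∀ x t, f x t ≠ 0)
    {l : ℂ} {φ : ℝ → ℝ → Fin 2 → ℂ} (hφ : IsLaxSolution ut l φ) :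
    IsLaxSolution (darbouxPotential ξ ut f) l
      (fun x t => darbouxMatrix ξ (f x t) l *ᵥ φ x t) := by
  rw [isLaxSolution_iff]
  have e := fun x t => darbouxMatrix_mulVec hξ (hf x t) l (φ x t)
  simp only [e]
  constructor
  · have h0 := hφ.1.apply 0
    have h1 := hφ.1.apply 1
    have hq := hL.1.darbouxDiff b hf
    have hq' := hq.conj
    have hw := hL.1.ofReal_darbouxOmega b hf
    unfold Smooth₂ at *
    refine contDiff_pi.2 fun i => ?_
    fin_cases i
    · exact (contDiff_const.mul h0).sub (contDiff_const.mul ((hw.mul h0).add (hq.mul h1)))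
    · exact (contDiff_const.mul h1).sub (contDiff_const.mul ((hq'.mul h0).sub (hw.mul h1)))
  · intro x t
    obtain ⟨h0, h1, k0, k1⟩ := (isLaxSolution_iff.1 hφ).2 x t
    have hq := hasDerivAt_darbouxDiff_left hξ hL x t (hf x t)
    have hw := hasDerivAt_darbouxOmega_left hξ hL x t (hf x t)
    have kq := hasDerivAt_darbouxDiff_right hξ hL x t (hf x t)
    have kw := hasDerivAt_darbouxOmega_right hξ hL x t (hf x t)
    have hq' := hasDerivAt_conj hq
    have kq' := hasDerivAt_conj kq
    have hS := darbouxOmega_sq_add (b := b) (hf x t)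
    have hI := Complex.I_sq
    simp only [Matrix.cons_val_zero, Matrix.cons_val_one]
    rw [dX_darbouxPotential hξ hut.1 hL hf, darbouxPotential_eq hξ]
    refine ⟨?_, ?_, ?_, ?_⟩
    · refine ((h0.const_mul _).sub (((hw.mul h0).add (hq.mul h1)).const_mul _)).congr_deriv ?_
      generalize conj (darbouxDiff b f x t) = q' at *
      generalize darbouxDiff b f x t = q at *
      generalize (darbouxOmega b f x t : ℂ) = w at *
      generalize conj (ut x t) = z' at *
      clear h0 h1 k0 k1 hq hw kq kw hq' kq' e hf hL hut hφ
      grind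
    · refine ((h1.const_mul _).sub (((hq'.mul h0).sub (hw.mul h1)).const_mul _)).congr_deriv ?_
      simp only [map_add, map_sub, map_mul, map_neg, Complex.conj_I, Complex.conj_ofNat,
        Complex.conj_ofReal]
      generalize conj (darbouxDiff b f x t) = q' at *
      generalize darbouxDiff b f x t = q at *
      generalize (darbouxOmega b f x t : ℂ) = w at *
      generalize conj (ut x t) = z' at *
      clear h0 h1 k0 k1 hq hw kq kw hq' kq' e hf hL hut hφ
      grind
    · refine ((k0.const_mul _).sub (((kw.mul k0).add (kq.mul k1)).const_mul _)).congr_deriv ?_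
      simp only [map_add]
      generalize conj (darbouxDiff b f x t) = q' at *
      generalize darbouxDiff b f x t = q at *
      generalize (darbouxOmega b f x t : ℂ) = w at *
      generalize conj (ut x t) = z' at *
      generalize conj (dX ut x t) = v' at *
      clear h0 h1 k0 k1 hq hw kq kw hq' kq' e hf hL hut hφ
      grind
    · refine ((k1.const_mul _).sub (((kq'.mul k0).sub (kw.mul k1)).const_mul _)).congr_deriv ?_
      simp only [map_add, map_sub, map_mul, map_neg, Complex.conj_conj, Complex.conj_I,
        Complex.conj_ofNat, Complex.conj_ofReal]
      generalize conj (darbouxDiff b f x t) = q' at *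
      generalize darbouxDiff b f x t = q at *
      generalize (darbouxOmega b f x t : ℂ) = w at *
      generalize conj (ut x t) = z' at *
      generalize conj (dX ut x t) = v' at *
      clear h0 h1 k0 k1 hq hw kq kw hq' kq' e hf hL hut hφ
      grind

theorem darbouxOmega_sq (hξ : ξ = (a : ℂ) + Complex.I * (b : ℂ)) (ut : ℝ → ℝ → ℂ)
    (hf : ∀ x t, f x t ≠ 0) (x t : ℝ) :
    darbouxOmega b f x t ^ 2 = 4 * b ^ 2 - ‖darbouxPotential ξ ut f x t - ut x t‖ ^ 2 := by
  have h := darbouxOmega_sq_add (b := b) (hf x t)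
  rw [darbouxPotential_eq hξ, add_sub_cancel_left, eq_sub_iff_add_eq]
  rw [Complex.mul_conj'] at h
  exact_mod_cast h

theorem darbouxOmega_eq_sign_mul_sqrt (hξ : ξ = (a : ℂ) + Complex.I * (b : ℂ)) (ut : ℝ → ℝ → ℂ)
    (hf : ∀ x t, f x t ≠ 0) (x t : ℝ) :
    darbouxOmega b f x t = Real.sign (b * (‖f x t 0‖ ^ 2 - ‖f x t 1‖ ^ 2)) *
      √(4 * b ^ 2 - ‖darbouxPotential ξ ut f x t - ut x t‖ ^ 2) := by
  have hn := normSq₂_pos (hf x t)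
  have e : darbouxOmega b f x t =
      2 * (b * (‖f x t 0‖ ^ 2 - ‖f x t 1‖ ^ 2)) / normSq₂ (f x t) := by
    rw [darbouxOmega, mul_assoc]
  rw [← darbouxOmega_sq hξ ut hf, Real.sqrt_sq_eq_abs]
  rcases lt_trichotomy (b * (‖f x t 0‖ ^ 2 - ‖f x t 1‖ ^ 2)) 0 with h | h | h
  · have : darbouxOmega b f x t < 0 := by
      rw [e]; exact div_neg_of_neg_of_pos (by linarith) hn
    rw [Real.sign_of_neg h, abs_of_neg this]; ring
  · rw [h, Real.sign_zero, e, h]; simp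
  · have : 0 < darbouxOmega b f x t := by rw [e]; positivity
    rw [Real.sign_of_pos h, abs_of_pos this]; ring

theorem isRootBranch_darbouxOmega (hξ : ξ = (a : ℂ) + Complex.I * (b : ℂ)) (ut : ℝ → ℝ → ℂ)
    (hs : Smooth₂ f) (hf : ∀ x t, f x t ≠ 0) :
    IsRootBranch b (darbouxPotential ξ ut f) ut f (darbouxOmega b f) :=
  ⟨hs.darbouxOmega b hf, fun x t =>
    ⟨darbouxOmega_sq hξ ut hf x t, darbouxOmega_eq_sign_mul_sqrt hξ ut hf x t⟩⟩

/-- At x = 0 both ũ and ũ_t vanish. The space part expresses ũ_x through u_x and u; substituting it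
into the time part and using Ω² = 4b² - |u|² gives (∗). -/
theorem satisfiesBoundaryCondition_darbouxPotential (hξ : ξ = (a : ℂ) + Complex.I * (b : ℂ))
    (hut : Smooth₂ ut) (hL : IsLaxSolution ut ξ f) (hf : ∀ x t, f x t ≠ 0)
    (hD : IsDirichlet ut) :
    SatisfiesBoundaryCondition a b (darbouxPotential ξ ut f) f := by
  intro t
  have hn := normSq₂_pos (hf 0 t)
  have hsq := darbouxOmega_sq hξ ut hf 0 t
  have hB : BoundaryConditionAt a b (darbouxPotential ξ ut f) (darbouxOmega b f 0 t) t := by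
    obtain ⟨hx, ht⟩ := isBacklundPair_darbouxPotential hξ hut hL hf 0 t
    have hT : dT ut 0 t = 0 := by
      have : (fun s => ut 0 s) = fun _ => 0 := funext hD
      simp [dT, this]
    have hc : (darbouxOmega b f 0 t : ℂ) ^ 2 =
        4 * b ^ 2 - (‖darbouxPotential ξ ut f 0 t‖ : ℂ) ^ 2 := by
      rw [hD t, sub_zero] at hsq
      exact_mod_cast hsq
    have hI := Complex.I_sq
    rw [hD t] at hx ht
    rw [hT] at ht
    simp only [norm_zero, Complex.ofReal_zero] at ht
    unfold BoundaryConditionAt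
    generalize (darbouxOmega b f 0 t : ℂ) = w at *
    generalize (‖darbouxPotential ξ ut f 0 t‖ : ℂ) = r at *
    clear hL hf hD hut hn hsq hT
    grind
  have hsg : ∀ r : ℝ, r = darbouxOmega b f 0 t →
      BoundaryConditionAt a b (darbouxPotential ξ ut f) r t := by
    rintro _ rfl; exact hB
  have e : darbouxOmega b f 0 t =
      2 * (b * (‖f 0 t 0‖ ^ 2 - ‖f 0 t 1‖ ^ 2)) / normSq₂ (f 0 t) := by
    rw [darbouxOmega, mul_assoc]
  rw [hD t, sub_zero] at hsq
  -- Ω has the sign of b(|f₁|² - |f₂|²), so it is the root required in each case; where it vanishes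
  -- the two roots agree.
  refine ⟨by nlinarith [sq_nonneg (darbouxOmega b f 0 t)], fun h => hsg _ ?_, fun h => hsg _ ?_⟩
  · have : 0 ≤ darbouxOmega b f 0 t := by rw [e]; positivity
    rw [← hsq, Real.sqrt_sq this]
  · have : darbouxOmega b f 0 t ≤ 0 := by
      rw [e]; exact div_nonpos_of_nonpos_of_nonneg (by linarith) hn.le
    rw [← hsq, Real.sqrt_sq_eq_abs, abs_of_nonpos this, neg_neg]

end Step

/-! ### Linear algebra of a single Darboux matrix -/

/-- The vector `(-v̄₂, v̄₁)` orthogonal to `v`. -/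
def perp (v : Fin 2 → ℂ) : Fin 2 → ℂ := ![-conj (v 1), conj (v 0)]

/-- The Hermitian product `v̄₁ w₁ + v̄₂ w₂`. -/
def herm (v w : Fin 2 → ℂ) : ℂ := conj (v 0) * w 0 + conj (v 1) * w 1

theorem darbouxMatrix_mulVec_eq (ζ : ℂ) (g : Fin 2 → ℂ) (l : ℂ) (v : Fin 2 → ℂ) :
    darbouxMatrix ζ g l *ᵥ v =
      (l - conj ζ) • v + ((conj ζ - ζ) / (g 0 * conj (g 0) + g 1 * conj (g 1)) * herm g v) • g := by
  ext i
  fin_cases i <;>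
  · simp [darbouxMatrix, Matrix.mulVec, dotProduct, Fin.sum_univ_two, ofReal_normSq₂, herm,
      ← Complex.mul_conj']
    ring

theorem darbouxMatrix_self_mulVec (ζ : ℂ) {g : Fin 2 → ℂ} (hg : g ≠ 0) :
    darbouxMatrix ζ g ζ *ᵥ g = 0 := by
  have hn := mul_conj_add_ne_zero hg
  have e : herm g g = g 0 * conj (g 0) + g 1 * conj (g 1) := by unfold herm; ring
  rw [darbouxMatrix_mulVec_eq, e, div_mul_cancel₀ _ hn, ← add_smul]
  simp

theorem det_darbouxMatrix (ζ : ℂ) {g : Fin 2 → ℂ} (hg : g ≠ 0) (l : ℂ) :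
    (darbouxMatrix ζ g l).det = (l - ζ) * (l - conj ζ) := by
  have hn := mul_conj_add_ne_zero hg
  rw [Matrix.det_fin_two]
  simp [darbouxMatrix, ofReal_normSq₂, ← Complex.mul_conj']
  field_simp
  ring

/-- The matrix has eigenvalue λ - ζ on `g` and λ - ζ̄ on `perp g`. The antilinear map `perp`
exchanges these two lines, so it intertwines the matrices at λ and λ̄. -/
theorem darbouxMatrix_conj_mulVec_perp_eq (ζ : ℂ) {g : Fin 2 → ℂ} (hg : g ≠ 0) (l : ℂ)
    (v : Fin 2 → ℂ) :
    darbouxMatrix ζ g (conj l) *ᵥ perp v = perp (darbouxMatrix ζ g l *ᵥ v) := by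
  have hn := mul_conj_add_ne_zero hg
  rw [darbouxMatrix_mulVec_eq, darbouxMatrix_mulVec_eq]
  ext i
  fin_cases i
  · simp [perp, herm]
    rw [mul_comm (conj (g 0)) (g 0), mul_comm (conj (g 1)) (g 1)]
    field_simp
    ring
  · simp [perp, herm]
    rw [mul_comm (conj (g 0)) (g 0), mul_comm (conj (g 1)) (g 1)]
    field_simp
    ring

/-- D(l)* D(l̄) is scalar: both factors are diagonal in the orthogonal basis `g`, `perp g`, with
complementary eigenvalues. -/
theorem herm_darbouxMatrix_mulVec (ζ : ℂ) {g : Fin 2 → ℂ} (hg : g ≠ 0) (l : ℂ)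
    (v w : Fin 2 → ℂ) :
    herm (darbouxMatrix ζ g l *ᵥ v) (darbouxMatrix ζ g (conj l) *ᵥ w) =
      (conj l - ζ) * (conj l - conj ζ) * herm v w := by
  have hn := mul_conj_add_ne_zero hg
  rw [darbouxMatrix_mulVec_eq, darbouxMatrix_mulVec_eq]
  simp [herm]
  rw [mul_comm (conj (g 0)) (g 0), mul_comm (conj (g 1)) (g 1)]
  field_simp
  ring

theorem freeLax_ne_zero {A B : ℂ} (h : A ≠ 0 ∨ B ≠ 0) (l : ℂ) (x t : ℝ) :
    freeLax A B l x t ≠ 0 := by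
  intro h0
  have e0 := congrFun h0 0
  have e1 := congrFun h0 1
  simp [freeLax, Complex.exp_ne_zero] at e0 e1
  tauto

/-! ### The chain of Darboux matrices: kernels, determinant, nonvanishing -/

section Chain

variable {κ c d : ℕ → ℂ} {m : ℕ} {x t : ℝ}

theorem chain_succ_mulVec (κ c d : ℕ → ℂ) (m : ℕ) (l : ℂ) (x t : ℝ) (v : Fin 2 → ℂ) :
    chain κ c d (m + 1) l x t *ᵥ v =
      darbouxMatrix (lam κ m) (chainVec κ c d m x t) l *ᵥ (chain κ c d m l x t *ᵥ v) := by
  rw [Matrix.mulVec_mulVec]; rfl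

theorem chain_conj_mulVec_perp (hv : ∀ k < m, chainVec κ c d k x t ≠ 0) (l : ℂ)
    (v : Fin 2 → ℂ) :
    chain κ c d m (conj l) x t *ᵥ perp v = perp (chain κ c d m l x t *ᵥ v) := by
  induction m with
  | zero => simp [chain]
  | succ m ih =>
    rw [chain_succ_mulVec, chain_succ_mulVec, ih fun k hk => hv k (by omega),
      darbouxMatrix_conj_mulVec_perp_eq _ (hv m (by omega))]

theorem chain_mulVec_seed (hv : ∀ k < m, chainVec κ c d k x t ≠ 0) {k : ℕ} (hk : k < m) :
    chain κ c d m (lam κ k) x t *ᵥ seed κ c d k x t = 0 := by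
  induction m with
  | zero => omega
  | succ m ih =>
    rw [chain_succ_mulVec]
    rcases Nat.lt_succ_iff_lt_or_eq.1 hk with h | rfl
    · rw [ih (fun k hk => hv k (by omega)) h, Matrix.mulVec_zero]
    · exact darbouxMatrix_self_mulVec _ (hv k hk)

theorem chain_conj_mulVec_perp_seed (hv : ∀ k < m, chainVec κ c d k x t ≠ 0) {k : ℕ}
    (hk : k < m) :
    chain κ c d m (conj (lam κ k)) x t *ᵥ perp (seed κ c d k x t) = 0 := by
  rw [chain_conj_mulVec_perp hv, chain_mulVec_seed hv hk]
  ext i; fin_cases i <;> simp [perp]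

theorem det_chain (hv : ∀ k < m, chainVec κ c d k x t ≠ 0) (l : ℂ) :
    (chain κ c d m l x t).det =
      ∏ k ∈ Finset.range m, (l - lam κ k) * (l - conj (lam κ k)) := by
  induction m with
  | zero => simp [chain]
  | succ m ih =>
    rw [Finset.prod_range_succ, ← ih fun k hk => hv k (by omega)]
    change (darbouxMatrix (lam κ m) (chainVec κ c d m x t) l * chain κ c d m l x t).det = _
    rw [Matrix.det_mul, det_darbouxMatrix _ (hv m (by omega)), mul_comm]

theorem mulVec_ne_zero_of_det_ne_zero {M : Matrix (Fin 2) (Fin 2) ℂ} (hM : M.det ≠ 0)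
    {v : Fin 2 → ℂ} (hv : v ≠ 0) : M *ᵥ v ≠ 0 := fun h =>
  hM (Matrix.exists_mulVec_eq_zero_iff.1 ⟨v, hv, h⟩)

theorem det_chain_ne_zero (hv : ∀ k < m, chainVec κ c d k x t ≠ 0) {l : ℂ}
    (hl : ∀ k < m, l ≠ lam κ k ∧ l ≠ conj (lam κ k)) : (chain κ c d m l x t).det ≠ 0 := by
  rw [det_chain hv, Finset.prod_ne_zero_iff]
  intro k hk
  obtain ⟨h1, h2⟩ := hl k (Finset.mem_range.1 hk)
  exact mul_ne_zero (sub_ne_zero.2 h1) (sub_ne_zero.2 h2)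

theorem seed_ne_zero {N : ℕ} (h : AdmissibleData N κ c d) {k : ℕ} (hk : k < 2 * N) (x t : ℝ) :
    seed κ c d k x t ≠ 0 :=
  freeLax_ne_zero (h.2 (k / 2) (by omega)) _ x t

/-- The determinant of the first m factors has zeros only at λ_k and λ̄_k with k < m, and
admissibility keeps λ_m away from these. -/
theorem chainVec_ne_zero {N : ℕ} (h : AdmissibleData N κ c d) (x t : ℝ) :
    ∀ m < 2 * N, chainVec κ c d m x t ≠ 0 := by
  intro m
  induction m using Nat.strong_induction_on with
  | _ m ih =>
    intro hm
    exact mulVec_ne_zero_of_det_ne_zero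
      (det_chain_ne_zero (fun k hk => ih k hk (by omega))
        fun k hk => h.1 m hm k (by omega) (by omega)) (seed_ne_zero h hm x t)

theorem herm_chain_mulVec (hv : ∀ k < m, chainVec κ c d k x t ≠ 0) (l : ℂ)
    (v w : Fin 2 → ℂ) :
    herm (chain κ c d m l x t *ᵥ v) (chain κ c d m (conj l) x t *ᵥ w) =
      (∏ k ∈ Finset.range m, (conj l - lam κ k) * (conj l - conj (lam κ k))) * herm v w := by
  induction m with
  | zero => simp [chain]
  | succ m ih =>
    rw [chain_succ_mulVec, chain_succ_mulVec, herm_darbouxMatrix_mulVec _ (hv m (by omega)),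
      ih fun k hk => hv k (by omega), Finset.prod_range_succ]
    ring

/-- The exponentials at l and its conjugate cancel, so the pairing does not depend on (x, t); hence
nonvanishing everywhere reduces to a condition on constants. -/
theorem herm_freeLax_conj (A B A' B' l : ℂ) (x t : ℝ) :
    herm (freeLax A' B' l x t) (freeLax A B (conj l) x t) = A * conj A' + B * conj B' := by
  have key : ∀ z w : ℂ, w = -z → Complex.exp z * Complex.exp w = 1 := by
    rintro z _ rfl; rw [← Complex.exp_add]; simp
  have e0 := key (conj (-Complex.I * l * x - 2 * Complex.I * l ^ 2 * t))
    (-Complex.I * conj l * x - 2 * Complex.I * conj l ^ 2 * t) (by simp [Complex.conj_ofNat]; ring)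
  have e1 := key (conj (Complex.I * l * x + 2 * Complex.I * l ^ 2 * t))
    (Complex.I * conj l * x + 2 * Complex.I * conj l ^ 2 * t) (by simp [Complex.conj_ofNat]; ring)
  simp only [herm, freeLax, Matrix.cons_val_zero, Matrix.cons_val_one, map_mul,
    ← Complex.exp_conj]
  linear_combination (A * conj A') * e0 + (B * conj B') * e1

theorem chain_mulVec_ne_zero_of_succ {N : ℕ} (h : AdmissibleData N κ c d) {k : ℕ}
    (hk : k < 2 * N) {v : Fin 2 → ℂ}
    (h0 : chain κ c d (k + 1) (conj (lam κ k)) x t *ᵥ v ≠ 0) {m : ℕ} (hkm : k < m)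
    (hm : m ≤ 2 * N) : chain κ c d m (conj (lam κ k)) x t *ᵥ v ≠ 0 := by
  induction m, Nat.succ_le_of_lt hkm using Nat.le_induction with
  | base => exact h0
  | succ m hkm' ih =>
    rw [chain_succ_mulVec]
    refine mulVec_ne_zero_of_det_ne_zero ?_ (ih (by omega) (by omega))
    rw [det_darbouxMatrix _ (chainVec_ne_zero h x t m (by omega))]
    obtain ⟨h1, h2⟩ := h.1 k hk m (by omega) (by omega)
    refine mul_ne_zero (sub_ne_zero.2 fun e => h2 ?_) (sub_ne_zero.2 fun e => h1 ?_)
    · rw [← e, Complex.conj_conj]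
    · exact (starRingEnd ℂ).injective e

/-- Away from all λ_k and λ̄_k the chain is invertible. At ξ = λ̄_k only the k-th factor is
singular, and its kernel is avoided exactly when A c̄ + B d̄ ≠ 0. -/
theorem solitonLax_ne_zero {N : ℕ} (h : AdmissibleData N κ c d) {A B ξ : ℂ}
    (hAB : A ≠ 0 ∨ B ≠ 0) (hξ : ∀ k < 2 * N, ξ ≠ lam κ k)
    (hξ' : ∀ k < 2 * N, ξ = conj (lam κ k) → A * conj (c (k / 2)) + B * conj (d (k / 2)) ≠ 0)
    (x t : ℝ) : solitonLax N κ c d A B ξ x t ≠ 0 := by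
  have hv := chainVec_ne_zero h x t
  by_cases hex : ∃ k < 2 * N, ξ = conj (lam κ k)
  · obtain ⟨k, hk, rfl⟩ := hex
    have hne := hξ k hk
    refine chain_mulVec_ne_zero_of_succ h hk ?_ hk le_rfl
    -- At the conjugate parameter the scalar part drops out: the factor is a multiple of the
    -- projection onto its own vector, so only a Hermitian product must be nonzero.
    rw [chain_succ_mulVec, darbouxMatrix_mulVec_eq, sub_self, zero_smul, zero_add]
    refine smul_ne_zero (mul_ne_zero (div_ne_zero (sub_ne_zero.2 hne)
      (mul_conj_add_ne_zero (hv k hk))) ?_) (hv k hk)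
    rw [chainVec, herm_chain_mulVec fun j hj => hv j (by omega), seed, herm_freeLax_conj]
    refine mul_ne_zero (Finset.prod_ne_zero_iff.2 fun j hj => ?_) (hξ' k hk rfl)
    have hj := Finset.mem_range.1 hj
    obtain ⟨h1, h2⟩ := h.1 k hk j (by omega) (by omega)
    refine mul_ne_zero (sub_ne_zero.2 fun e => h2 ?_) (sub_ne_zero.2 fun e => h1 ?_)
    · rw [← e, Complex.conj_conj]
    · exact (starRingEnd ℂ).injective e
  · push Not at hex
    exact mulVec_ne_zero_of_det_ne_zero
      (det_chain_ne_zero hv fun k hk => ⟨hξ k hk, hex k hk⟩) (freeLax_ne_zero hAB _ x t)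

end Chain

/-! ### Rows of polynomials and division by Darboux matrices -/

open Polynomial

/-- The row `(r₁, r₂)` of polynomials annihilates the vectors `v_k` at `λ_k` and `v_k^⊥` at the
conjugate of `λ_k`, for all `k < m`. -/
def AnnihilatesSeeds (κ c d : ℕ → ℂ) (m : ℕ) (x t : ℝ) (r : Fin 2 → ℂ[X]) : Prop :=
  ∀ k < m, (fun i => (r i).eval (lam κ k)) ⬝ᵥ seed κ c d k x t = 0 ∧
    (fun i => (r i).eval (conj (lam κ k))) ⬝ᵥ perp (seed κ c d k x t) = 0

theorem exists_eq_X_sub_C_mul {p : ℂ[X]} {z : ℂ} {n : ℕ} (hz : p.eval z = 0)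
    (hp : p.degree < (n + 1 : ℕ)) : ∃ q : ℂ[X], p = (X - C z) * q ∧ q.degree < n := by
  obtain ⟨q, rfl⟩ := dvd_iff_isRoot.2 hz
  refine ⟨q, rfl, ?_⟩
  by_cases hq : q = 0
  · simp [hq, bot_lt_iff_ne_bot]
  · rw [degree_mul, degree_X_sub_C, degree_eq_natDegree hq] at hp
    rw [degree_eq_natDegree hq]
    norm_cast at hp ⊢
    omega

theorem degree_C_mul_add_C_mul_lt {p q : ℂ[X]} {n : ℕ} (hp : p.degree < n) (hq : q.degree < n)
    (α β : ℂ) : (C α * p + C β * q).degree < n := by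
  have h : C α * p + C β * q ∈ degreeLT ℂ n := by
    rw [← smul_eq_C_mul, ← smul_eq_C_mul]
    exact add_mem (Submodule.smul_mem _ _ (mem_degreeLT.2 hp))
      (Submodule.smul_mem _ _ (mem_degreeLT.2 hq))
  exact mem_degreeLT.1 h

/-- Right division of a row of polynomials by a Darboux matrix. -/
theorem exists_vecMul_darbouxMatrix {s : Fin 2 → ℂ[X]} {n : ℕ}
    (hs : ∀ i, (s i).degree < (n + 1 : ℕ)) {ζ : ℂ} {g : Fin 2 → ℂ} (hg : g ≠ 0)
    (h1 : (fun i => (s i).eval ζ) ⬝ᵥ g = 0)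
    (h2 : (fun i => (s i).eval (conj ζ)) ⬝ᵥ perp g = 0) :
    ∃ s' : Fin 2 → ℂ[X], (∀ i, (s' i).degree < n) ∧
      ∀ l, (fun i => (s i).eval l) = (fun i => (s' i).eval l) ᵥ* darbouxMatrix ζ g l := by
  have hn := mul_conj_add_ne_zero hg
  obtain ⟨α, hα, hα'⟩ := exists_eq_X_sub_C_mul (p := C (g 0) * s 0 + C (g 1) * s 1) (z := ζ)
    (by simp [dotProduct, Fin.sum_univ_two] at h1 ⊢; linear_combination h1)
    (degree_C_mul_add_C_mul_lt (hs 0) (hs 1) _ _)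
  obtain ⟨β, hβ, hβ'⟩ := exists_eq_X_sub_C_mul
    (p := C (-conj (g 1)) * s 0 + C (conj (g 0)) * s 1) (z := conj ζ)
    (by simp [dotProduct, Fin.sum_univ_two, perp] at h2 ⊢; linear_combination h2)
    (degree_C_mul_add_C_mul_lt (hs 0) (hs 1) _ _)
  set n' := g 0 * conj (g 0) + g 1 * conj (g 1) with hn'
  -- The quotient row must pair to α with `g` and to β with `perp g`, because the Darboux matrix
  -- multiplies these vectors by λ - ζ and λ - ζ̄. This is its expansion in the dual basis.
  refine ⟨![C (conj (g 0) / n') * α + C (-g 1 / n') * β,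
    C (conj (g 1) / n') * α + C (g 0 / n') * β], fun i => ?_, fun l => ?_⟩
  · fin_cases i
    · exact degree_C_mul_add_C_mul_lt hα' hβ' _ _
    · exact degree_C_mul_add_C_mul_lt hα' hβ' _ _
  · have e1 := congrArg (eval l) hα
    have e2 := congrArg (eval l) hβ
    simp only [eval_add, eval_mul, eval_C, eval_sub, eval_X] at e1 e2
    ext i
    fin_cases i
    · simp [darbouxMatrix, Matrix.vecMul, dotProduct, Fin.sum_univ_two, ofReal_normSq₂,
        ← Complex.mul_conj']
      rw [← hn']
      field_simp
      rw [hn']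
      linear_combination (conj (g 0)) * (g 0 * conj (g 0) + g 1 * conj (g 1)) * e1
        - g 1 * (g 0 * conj (g 0) + g 1 * conj (g 1)) * e2
    · simp [darbouxMatrix, Matrix.vecMul, dotProduct, Fin.sum_univ_two, ofReal_normSq₂,
        ← Complex.mul_conj']
      rw [← hn']
      field_simp
      rw [hn']
      linear_combination (conj (g 1)) * (g 0 * conj (g 0) + g 1 * conj (g 1)) * e1
        + g 0 * (g 0 * conj (g 0) + g 1 * conj (g 1)) * e2

section Chain

variable {κ c d : ℕ → ℂ} {m : ℕ} {x t : ℝ}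

/-- Once the first m factors are divided out, annihilating the m-th seed and its orthogonal vector
becomes annihilating `chainVec` and its `perp`, which is what division by the next factor needs. -/
theorem AnnihilatesSeeds.exists_vecMul_chain {r : Fin 2 → ℂ[X]}
    (hr : AnnihilatesSeeds κ c d m x t r) (hv : ∀ k < m, chainVec κ c d k x t ≠ 0) {n : ℕ}
    (hd : ∀ i, (r i).degree < (n + m : ℕ)) :
    ∃ s : Fin 2 → ℂ[X], (∀ i, (s i).degree < n) ∧
      ∀ l, (fun i => (r i).eval l) = (fun i => (s i).eval l) ᵥ* chain κ c d m l x t := by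
  induction m generalizing n with
  | zero => exact ⟨r, hd, fun l => by simp [chain]⟩
  | succ m ih =>
    obtain ⟨s, hs, hrs⟩ := ih (fun k hk => hr k (by omega)) (fun k hk => hv k (by omega))
      (n := n + 1) (fun i => by convert hd i using 2; omega)
    obtain ⟨h1, h2⟩ := hr m (by omega)
    rw [hrs, ← Matrix.dotProduct_mulVec] at h1
    rw [hrs, ← Matrix.dotProduct_mulVec, chain_conj_mulVec_perp fun k hk => hv k (by omega)] at h2
    obtain ⟨s', hs', hss'⟩ := exists_vecMul_darbouxMatrix hs (hv m (by omega)) h1 h2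
    refine ⟨s', hs', fun l => ?_⟩
    rw [hrs, hss', Matrix.vecMul_vecMul]
    rfl

theorem AnnihilatesSeeds.eq_zero {r : Fin 2 → ℂ[X]}
    (hr : AnnihilatesSeeds κ c d m x t r) (hv : ∀ k < m, chainVec κ c d k x t ≠ 0)
    (hd : ∀ i, (r i).degree < m) : r = 0 := by
  obtain ⟨s, hs, hrs⟩ := hr.exists_vecMul_chain hv (n := 0) (by simpa using hd)
  have hs0 : s = 0 := by
    ext1 i
    simpa using hs i
  funext i
  refine Polynomial.funext fun l => ?_
  have := congrFun (hrs l) i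
  simpa [hs0, Matrix.vecMul, dotProduct] using this

/-- The potential obtained from zero by the first `m` Darboux transformations of the chain. -/
def chainPotential (κ c d : ℕ → ℂ) : ℕ → ℝ → ℝ → ℂ
  | 0 => fun _ _ => 0
  | m + 1 => darbouxPotential (lam κ m) (chainPotential κ c d m) (chainVec κ c d m)

/-- The entries of the chain are polynomials in `l`, and the potential is a coefficient. -/
theorem exists_chain_eq_eval (κ c d : ℕ → ℂ) (m : ℕ) (x t : ℝ) :
    ∃ R : Matrix (Fin 2) (Fin 2) ℂ[X], (∀ i j, (R i j).degree < m) ∧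
      (∀ l i j, chain κ c d m l x t i j = (if i = j then l ^ m else 0) + (R i j).eval l) ∧
      chainPotential κ c d m x t = 2 * Complex.I * (R 0 1).coeff (m - 1) := by
  induction m with
  | zero =>
    refine ⟨0, fun i j => by simp [bot_lt_iff_ne_bot], fun l i j => ?_, by simp [chainPotential]⟩
    simp [chain, Matrix.one_apply]
  | succ m ih =>
    obtain ⟨R, hR, hc, hp⟩ := ih
    obtain ⟨S, hS, hS01⟩ : ∃ S : Matrix (Fin 2) (Fin 2) ℂ,
        (∀ l, darbouxMatrix (lam κ m) (chainVec κ c d m x t) l = l • 1 + S) ∧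
        S 0 1 = (conj (lam κ m) - lam κ m) / normSq₂ (chainVec κ c d m x t) *
          (chainVec κ c d m x t 0 * conj (chainVec κ c d m x t 1)) := by
      refine ⟨darbouxMatrix (lam κ m) (chainVec κ c d m x t) 0, fun l => ?_, ?_⟩
      · unfold darbouxMatrix; module
      · simp [darbouxMatrix]
    -- Lower-order part of (X + S)(Xᵐ + R), that is XR + SR + S Xᵐ.
    refine ⟨fun i j => X * R i j + (C (S i 0) * R 0 j + C (S i 1) * R 1 j) + C (S i j) * X ^ m,
      fun i j => ?_, fun l i j => ?_, ?_⟩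
    · rw [← mem_degreeLT]
      refine add_mem (add_mem ?_ ?_) ?_ <;> rw [mem_degreeLT]
      · by_cases h0 : R i j = 0
        · simp [h0, bot_lt_iff_ne_bot]
        · have := hR i j
          rw [degree_mul, degree_X, degree_eq_natDegree h0]
          rw [degree_eq_natDegree h0] at this
          norm_cast at this ⊢
          omega
      · exact (degree_C_mul_add_C_mul_lt (hR 0 j) (hR 1 j) _ _).trans (by norm_cast; omega)
      · exact (degree_C_mul_X_pow_le m _).trans_lt (by norm_cast; omega)
    · have e : chain κ c d (m + 1) l x t = (l • 1 + S) * chain κ c d m l x t := by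
        rw [← hS]; rfl
      rw [e, Matrix.mul_apply, Fin.sum_univ_two, hc, hc]
      fin_cases i <;> fin_cases j <;> simp <;> ring
    · have hR0 : ∀ i j, (R i j).coeff m = 0 := fun i j => coeff_eq_zero_of_degree_lt (hR i j)
      -- For m = 0 the truncated index m - 1 is 0; both sides vanish since `R` is then zero.
      have hX : (X * R 0 1).coeff m = (R 0 1).coeff (m - 1) := by
        cases m with
        | zero => simpa using (hR0 0 1).symm
        | succ m => simp
      simp only [Nat.add_sub_cancel, coeff_add, hX, coeff_C_mul, hR0, coeff_X_pow, chainPotential,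
        darbouxPotential, hp, hS01, if_true]
      ring

/-! ### Solutions produced by the chain from the zero potential -/

theorem isNLSSolution_zero : IsNLSSolution fun _ _ => 0 := by
  refine ⟨contDiff_const, fun x t => ?_⟩
  simp [dX, dT]

theorem isLaxSolution_freeLax (A B l : ℂ) :
    IsLaxSolution (fun _ _ => 0) l (freeLax A B l) := by
  rw [isLaxSolution_iff]
  have hx : ContDiff ℝ ∞ (fun p : ℝ × ℝ => (p.1 : ℂ)) :=
    Complex.ofRealCLM.contDiff.comp contDiff_fst
  have ht : ContDiff ℝ ∞ (fun p : ℝ × ℝ => (p.2 : ℂ)) :=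
    Complex.ofRealCLM.contDiff.comp contDiff_snd
  constructor
  · refine contDiff_pi.2 fun i => ?_
    fin_cases i
    · exact contDiff_const.mul ((contDiff_const.mul hx).sub (contDiff_const.mul ht)).cexp
    · exact contDiff_const.mul ((contDiff_const.mul hx).add (contDiff_const.mul ht)).cexp
  · intro x t
    have h : ∀ y : ℝ, HasDerivAt (fun y : ℝ => (y : ℂ)) 1 y := fun y =>
      Complex.ofRealCLM.hasDerivAt
    refine ⟨?_, ?_, ?_, ?_⟩
    · refine (((((h x).const_mul (-Complex.I * l)).sub_const
        (2 * Complex.I * l ^ 2 * t)).cexp).const_mul A).congr_deriv ?_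
      simp [freeLax]; ring
    · refine (((((h x).const_mul (Complex.I * l)).add_const
        (2 * Complex.I * l ^ 2 * t)).cexp).const_mul B).congr_deriv ?_
      simp [freeLax]; ring
    · refine (((((h t).const_mul (2 * Complex.I * l ^ 2)).const_sub
        (-Complex.I * l * x)).cexp).const_mul A).congr_deriv ?_
      simp [freeLax, dX]; ring
    · refine (((((h t).const_mul (2 * Complex.I * l ^ 2)).const_add
        (Complex.I * l * x)).cexp).const_mul B).congr_deriv ?_
      simp [freeLax, dX]; ring

theorem chainPotential_isSolution (hv : ∀ x t, ∀ k < m, chainVec κ c d k x t ≠ 0) :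
    IsNLSSolution (chainPotential κ c d m) ∧ ∀ A B l, IsLaxSolution (chainPotential κ c d m) l
      (fun x t => chain κ c d m l x t *ᵥ freeLax A B l x t) := by
  induction m with
  | zero =>
    refine ⟨isNLSSolution_zero, fun A B l => ?_⟩
    simp only [chain, Matrix.one_mulVec]
    exact isLaxSolution_freeLax A B l
  | succ m ih =>
    obtain ⟨hN, hL⟩ := ih fun x t k hk => hv x t k (by omega)
    have hz : lam κ m = ((lam κ m).re : ℂ) + Complex.I * ((lam κ m).im : ℂ) := by
      rw [mul_comm, Complex.re_add_im]
    have hf : IsLaxSolution (chainPotential κ c d m) (lam κ m) (chainVec κ c d m) := hL _ _ _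
    have hne : ∀ x t, chainVec κ c d m x t ≠ 0 := fun x t => hv x t m (by omega)
    refine ⟨isNLSSolution_darbouxPotential hz hN hf hne, fun A B l => ?_⟩
    simp only [chain_succ_mulVec]
    exact isLaxSolution_darbouxMatrix_mulVec hz hN hf hne (hL A B l)

end Chain

/-! ### The determinants Δ₁, Δ₂ and the Dirichlet condition -/

theorem degree_sum_C_mul_X_pow_lt {n : ℕ} (w : Fin n → ℂ) :
    (∑ i : Fin n, C (w i) * X ^ (n - 1 - (i : ℕ))).degree < (n : WithBot ℕ) := by
  rw [← mem_degreeLT]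
  refine Submodule.sum_mem _ fun i _ => mem_degreeLT.2 ?_
  refine (degree_C_mul_X_pow_le _ _).trans_lt ?_
  have := i.2
  norm_cast
  omega

theorem coeff_sum_C_mul_X_pow {n : ℕ} (w : Fin n → ℂ) (i : Fin n) :
    (∑ j : Fin n, C (w j) * X ^ (n - 1 - (j : ℕ))).coeff (n - 1 - (i : ℕ)) = w i := by
  rw [finsetSum_coeff, Finset.sum_eq_single i]
  · simp
  · intro j _ hj
    rw [coeff_C_mul_X_pow, if_neg]
    intro h
    exact hj (Fin.ext (by omega))
  · simp

theorem sum_coeff_C_mul_X_pow {n : ℕ} {p : ℂ[X]} (hp : p.degree < n) :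
    ∑ i : Fin n, C (p.coeff (n - 1 - (i : ℕ))) * X ^ (n - 1 - (i : ℕ)) = p := by
  ext k
  by_cases hk : k < n
  · have := coeff_sum_C_mul_X_pow (fun i : Fin n => p.coeff (n - 1 - (i : ℕ)))
      ⟨n - 1 - k, by omega⟩
    simpa [show n - 1 - (n - 1 - k) = k by omega] using this
  · have hk' : (n : WithBot ℕ) ≤ k := by norm_cast; omega
    rw [coeff_eq_zero_of_degree_lt (hp.trans_le hk'),
      coeff_eq_zero_of_degree_lt ((degree_sum_C_mul_X_pow_lt _).trans_le hk')]

/-- The row of polynomials whose coefficients are the entries of a vector indexed by the rows of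
`delta1Matrix`. -/
def rowPoly (N : ℕ) (v : Fin (2 * N) ⊕ Fin (2 * N) → ℂ) : Fin 2 → ℂ[X] :=
  ![∑ i : Fin (2 * N), C (v (Sum.inr i)) * X ^ (2 * N - 1 - (i : ℕ)),
    ∑ i : Fin (2 * N), C (v (Sum.inl i)) * X ^ (2 * N - 1 - (i : ℕ))]

section Determinants

variable {N : ℕ} {κ c d : ℕ → ℂ}

theorem vecMul_delta1Matrix_inl (v : Fin (2 * N) ⊕ Fin (2 * N) → ℂ) (x t : ℝ)
    (k : Fin (2 * N)) :
    (v ᵥ* delta1Matrix N κ c d x t) (Sum.inl k) =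
      (fun i => (rowPoly N v i).eval (lam κ k)) ⬝ᵥ seed κ c d k x t := by
  simp only [Matrix.vecMul, dotProduct, Fintype.sum_sum_type, delta1Matrix, Matrix.of_apply,
    Fin.sum_univ_two, rowPoly, Matrix.cons_val_zero, Matrix.cons_val_one, eval_finsetSum,
    eval_mul, eval_C, eval_pow, eval_X, Finset.sum_mul]
  rw [add_comm]
  simp only [mul_assoc]

theorem vecMul_delta1Matrix_inr (v : Fin (2 * N) ⊕ Fin (2 * N) → ℂ) (x t : ℝ)
    (k : Fin (2 * N)) :
    (v ᵥ* delta1Matrix N κ c d x t) (Sum.inr k) =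
      (fun i => (rowPoly N v i).eval (conj (lam κ k))) ⬝ᵥ perp (seed κ c d k x t) := by
  simp only [Matrix.vecMul, dotProduct, Fintype.sum_sum_type, delta1Matrix, Matrix.of_apply,
    Fin.sum_univ_two, rowPoly, Matrix.cons_val_zero, Matrix.cons_val_one, eval_finsetSum,
    eval_mul, eval_C, eval_pow, eval_X, Finset.sum_mul, perp]
  rw [add_comm]
  simp only [mul_assoc, mul_neg]

theorem det_delta1Matrix_ne_zero (h : AdmissibleData N κ c d) (x t : ℝ) :
    (delta1Matrix N κ c d x t).det ≠ 0 := by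
  intro h0
  obtain ⟨v, hv, hv0⟩ := Matrix.exists_vecMul_eq_zero_iff.2 h0
  have hr : AnnihilatesSeeds κ c d (2 * N) x t (rowPoly N v) := fun k hk =>
    ⟨by rw [← vecMul_delta1Matrix_inl v x t ⟨k, hk⟩, hv0]; rfl,
      by rw [← vecMul_delta1Matrix_inr v x t ⟨k, hk⟩, hv0]; rfl⟩
  have hz := hr.eq_zero (chainVec_ne_zero h x t) fun i => by
    fin_cases i <;> exact degree_sum_C_mul_X_pow_lt _
  refine hv (funext fun i => ?_)
  rcases i with i | i
  · rw [← coeff_sum_C_mul_X_pow (fun i => v (Sum.inl i)) i]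
    exact congrArg (fun p => coeff p (2 * N - 1 - (i : ℕ))) (congrFun hz 1)
  · rw [← coeff_sum_C_mul_X_pow (fun i => v (Sum.inr i)) i]
    exact congrArg (fun p => coeff p (2 * N - 1 - (i : ℕ))) (congrFun hz 0)

/-- Cramer's rule. The kernel relations of the chain say that the coefficients of the lower-order
part of its first row solve a linear system with matrix Δ₁ and the new row of Δ₂ as right-hand side.
-/
theorem chainPotential_eq_solitonPotential (h : AdmissibleData N κ c d) :
    chainPotential κ c d (2 * N) = solitonPotential N κ c d := by
  funext x t
  by_cases hN : N = 0
  · simp [hN, solitonPotential, chainPotential]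
  obtain ⟨R, hR, hc, hp⟩ := exists_chain_eq_eval κ c d (2 * N) x t
  have hv := chainVec_ne_zero h x t
  let v : Fin (2 * N) ⊕ Fin (2 * N) → ℂ :=
    Sum.elim (fun i => (R 0 1).coeff (2 * N - 1 - (i : ℕ)))
      (fun i => (R 0 0).coeff (2 * N - 1 - (i : ℕ)))
  have hvR : rowPoly N v = R 0 := by
    funext i
    fin_cases i
    · exact sum_coeff_C_mul_X_pow (hR 0 0)
    · exact sum_coeff_C_mul_X_pow (hR 0 1)
  -- From (λ^{2N} + R₀₀)μ + R₀₁ν = 0, and the same relation for the orthogonal vectors, `v` times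
  -- the matrix of Δ₁ is the new first row.
  have hrow : delta2Matrix N κ c d x t = (delta1Matrix N κ c d x t).updateRow
      (Sum.inl ⟨0, by omega⟩) (v ᵥ* delta1Matrix N κ c d x t) := by
    ext r s
    rcases r with i | i
    · by_cases hi : (i : ℕ) = 0
      · have hi' : i = ⟨0, by omega⟩ := Fin.ext hi
        rw [← hi']
        rw [Matrix.updateRow_self]
        rcases s with k | k
        · have e := congrFun (chain_mulVec_seed hv k.2) 0
          simp only [Matrix.mulVec, dotProduct, Fin.sum_univ_two, hc] at e
          simp [delta2Matrix, hi, vecMul_delta1Matrix_inl, hvR, dotProduct,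
            Fin.sum_univ_two] at e ⊢
          linear_combination -e
        · have e := congrFun (chain_conj_mulVec_perp_seed hv k.2) 0
          simp only [Matrix.mulVec, dotProduct, Fin.sum_univ_two, hc] at e
          simp [delta2Matrix, hi, vecMul_delta1Matrix_inr, hvR, dotProduct, perp,
            Fin.sum_univ_two] at e ⊢
          linear_combination -e
      · rw [Matrix.updateRow_ne fun e => hi (by simpa using congrArg Fin.val (Sum.inl.inj e))]
        cases s <;> simp [delta2Matrix, hi]
    · rw [Matrix.updateRow_ne (by simp)]
      rfl
  rw [solitonPotential, if_neg hN, hp, hrow, Matrix.vecMul_eq_sum, Matrix.det_updateRow_sum,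
    smul_eq_mul, mul_div_cancel_right₀ _ (det_delta1Matrix_ne_zero h x t)]
  rfl

/-- At x = 0 the seeds depend on λ only through λ², so λ and -λ impose their conditions with the
same vector. -/
theorem isDirichlet_solitonPotential (h : AdmissibleData N κ c d) :
    IsDirichlet (solitonPotential N κ c d) := by
  intro t
  rw [← chainPotential_eq_solitonPotential h]
  by_cases hN : N = 0
  · simp [hN, chainPotential]
  obtain ⟨R, hR, hc, hp⟩ := exists_chain_eq_eval κ c d (2 * N) 0 t
  have hv := chainVec_ne_zero h 0 t
  have hpair : ∀ k < 2 * N, ∃ k' < 2 * N, lam κ k' = -lam κ k ∧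
      seed κ c d k' 0 t = seed κ c d k 0 t := by
    intro k hk
    have key : ∀ k', k' / 2 = k / 2 → lam κ k' = -lam κ k →
        seed κ c d k' 0 t = seed κ c d k 0 t := by
      intro k' e1 e2
      simp [seed, freeLax, e1, e2]
    rcases Nat.mod_two_eq_zero_or_one k with hk' | hk'
    · have e1 : (k + 1) / 2 = k / 2 := by omega
      have e2 : lam κ (k + 1) = -lam κ k := by
        simp [lam, hk', e1, show (k + 1) % 2 = 1 by omega]
      exact ⟨k + 1, by omega, e2, key _ e1 e2⟩
    · have e1 : (k - 1) / 2 = k / 2 := by omega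
      have e2 : lam κ (k - 1) = -lam κ k := by
        simp [lam, hk', e1, show (k - 1) % 2 = 0 by omega]
      exact ⟨k - 1, by omega, e2, key _ e1 e2⟩
  -- R(λ) - R(-λ) annihilates all seeds, because the leading term λ^{2N} is even and cancels in the
  -- difference of the two kernel relations.
  let r : Fin 2 → ℂ[X] := fun j => R 0 j - (R 0 j).comp (C (-1) * X)
  have hev : ∀ l j, (r j).eval l = (R 0 j).eval l - (R 0 j).eval (-l) := by
    intro l j
    simp [r]
  have hcoeff : ∀ j n, (r j).coeff n = (R 0 j).coeff n - (R 0 j).coeff n * (-1) ^ n := by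
    intro j n
    rw [coeff_sub, comp_C_mul_X_coeff]
  have hpow : ∀ l : ℂ, (-l) ^ (2 * N) = l ^ (2 * N) := fun l => by
    rw [pow_mul, pow_mul, neg_sq]
  have hr : AnnihilatesSeeds κ c d (2 * N) 0 t r := by
    intro k hk
    obtain ⟨k', hk', e1, e2⟩ := hpair k hk
    have f1 := congrFun (chain_mulVec_seed hv hk) 0
    have f2 := congrFun (chain_mulVec_seed hv hk') 0
    have g1 := congrFun (chain_conj_mulVec_perp_seed hv hk) 0
    have g2 := congrFun (chain_conj_mulVec_perp_seed hv hk') 0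
    rw [e1, e2] at f2 g2
    rw [map_neg] at g2
    simp [Matrix.mulVec, dotProduct, Fin.sum_univ_two, hc, hpow] at f1 f2 g1 g2
    simp only [dotProduct, Fin.sum_univ_two, hev]
    exact ⟨by linear_combination f1 - f2, by linear_combination g1 - g2⟩
  have hz := hr.eq_zero hv fun j => (degree_lt_iff_coeff_zero _ _).2 fun n hn => by
    rw [hcoeff, (degree_lt_iff_coeff_zero _ _).1 (hR 0 j) n hn]; ring
  have h1 : (r 1).coeff (2 * N - 1) = 0 := by rw [hz]; simp
  -- As 2N - 1 is odd, this coefficient of `r` is twice that of `R 0 1`.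
  rw [hcoeff, Odd.neg_one_pow (by rw [Nat.odd_iff]; omega)] at h1
  rw [hp]
  linear_combination Complex.I * h1

end Determinants

/-! ### The explicit solution for N = 0 -/

section OneSoliton

variable {a b : ℝ} {ξ : ℂ}

theorem boundarySoliton_zero (hξ : ξ = (a : ℂ) + Complex.I * (b : ℂ)) (κ c d : ℕ → ℂ)
    (A B : ℂ) (x t : ℝ) :
    boundarySoliton 0 κ c d A B ξ x t = 4 * (b : ℂ) *
      (freeLax A B ξ x t 0 * conj (freeLax A B ξ x t 1) / (normSq₂ (freeLax A B ξ x t) : ℂ)) := by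
  have e : solitonLax 0 κ c d A B ξ x t = freeLax A B ξ x t := by simp [solitonLax, chain]
  rw [boundarySoliton, darbouxPotential, e, sub_conj_of_eq hξ, solitonPotential, if_pos rfl]
  linear_combination (-4 * (b : ℂ) * (freeLax A B ξ x t 0 * conj (freeLax A B ξ x t 1) /
    (normSq₂ (freeLax A B ξ x t) : ℂ))) * Complex.I_sq

theorem freeLax_mul_conj (hξ : ξ = (a : ℂ) + Complex.I * (b : ℂ)) (A B : ℂ) (x t : ℝ) :
    freeLax A B ξ x t 0 * conj (freeLax A B ξ x t 1) = A * conj B *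
      Complex.exp (-2 * Complex.I * a * x
        - 4 * Complex.I * ((a : ℂ) ^ 2 - (b : ℂ) ^ 2) * t) := by
  have e : -2 * Complex.I * a * x - 4 * Complex.I * ((a : ℂ) ^ 2 - (b : ℂ) ^ 2) * t =
      (-Complex.I * ξ * x - 2 * Complex.I * ξ ^ 2 * t) +
        conj (Complex.I * ξ * x + 2 * Complex.I * ξ ^ 2 * t) := by
    simp only [map_add, map_mul, map_pow, Complex.conj_I, Complex.conj_ofReal,
      Complex.conj_ofNat, conj_eq_of_eq hξ]
    rw [hξ]
    linear_combination (4 * Complex.I * b ^ 2 * t) * Complex.I_sq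
  rw [e, Complex.exp_add, Complex.exp_conj]
  simp only [freeLax, Matrix.cons_val_zero, Matrix.cons_val_one, map_mul]
  ring

/-- With E = bx + 4abt the two terms are |A|²e^{2E} and |B|²e^{-2E}; factoring out |A||B| leaves
e^{2E+θ} + e^{-2E-θ}. -/
theorem normSq₂_freeLax (hξ : ξ = (a : ℂ) + Complex.I * (b : ℂ)) {A B : ℂ} (hA : A ≠ 0)
    (hB : B ≠ 0) {θ : ℝ} (hθ : Real.exp θ = ‖A / B‖) (x t : ℝ) :
    normSq₂ (freeLax A B ξ x t) =
      2 * ‖A‖ * ‖B‖ * Real.cosh (2 * b * x + 8 * a * b * t + θ) := by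
  have hA' := norm_pos_iff.2 hA
  have hB' := norm_pos_iff.2 hB
  have e0 : (-Complex.I * ξ * x - 2 * Complex.I * ξ ^ 2 * t).re = b * x + 4 * a * b * t := by
    simp [hξ, pow_two, -mul_eq_mul_right_iff]; ring
  have e1 : (Complex.I * ξ * x + 2 * Complex.I * ξ ^ 2 * t).re = -(b * x + 4 * a * b * t) := by
    simp [hξ, pow_two, -mul_eq_mul_right_iff]; ring
  rw [norm_div] at hθ
  simp only [normSq₂, freeLax, Matrix.cons_val_zero, Matrix.cons_val_one, norm_mul,
    Complex.norm_exp, e0, e1]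
  have e2 : 2 * b * x + 8 * a * b * t + θ =
    (b * x + 4 * a * b * t) + (b * x + 4 * a * b * t) + θ := by ring
  rw [Real.cosh_eq, e2]
  generalize b * x + 4 * a * b * t = E
  rw [show -(E + E + θ) = -E + -E + -θ by ring, Real.exp_add, Real.exp_add, Real.exp_add,
    Real.exp_add, Real.exp_neg θ, hθ]
  field_simp

theorem boundarySoliton_zero_eq_cosh (hξ : ξ = (a : ℂ) + Complex.I * (b : ℂ)) (κ c d : ℕ → ℂ)
    {A B : ℂ} (hA : A ≠ 0) (hB : B ≠ 0) {θ₁ θ₂ : ℝ}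
    (h1 : Complex.exp (Complex.I * (θ₁ : ℂ)) = A * conj B / ((‖A‖ : ℂ) * (‖B‖ : ℂ)))
    (h2 : Real.exp θ₂ = ‖A / B‖) (x t : ℝ) :
    boundarySoliton 0 κ c d A B ξ x t
      = 2 * (b : ℂ) * Complex.exp (-2 * Complex.I * a * x
          - 4 * Complex.I * ((a : ℂ) ^ 2 - (b : ℂ) ^ 2) * t + Complex.I * θ₁) /
        (Real.cosh (2 * b * x + 8 * a * b * t + θ₂) : ℂ) := by
  have hA' : (‖A‖ : ℂ) ≠ 0 := by simpa using hA
  have hB' : (‖B‖ : ℂ) ≠ 0 := by simpa using hB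
  have hc : (Real.cosh (2 * b * x + 8 * a * b * t + θ₂) : ℂ) ≠ 0 := by
    exact_mod_cast (Real.cosh_pos _).ne'
  rw [boundarySoliton_zero hξ, freeLax_mul_conj hξ, normSq₂_freeLax hξ hA hB h2,
    Complex.exp_add, h1, Complex.ofReal_mul, Complex.ofReal_mul, Complex.ofReal_mul,
    Complex.ofReal_ofNat]
  generalize (Real.cosh (2 * b * x + 8 * a * b * t + θ₂) : ℂ) = C at *
  field_simp
  ring

end OneSoliton

end NLSBoundary

end

theorem mainTheorem4 (a b : ℝ) (ξ : ℂ) (hξ : ξ = (a : ℂ) + Complex.I * (b : ℂ)) :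
    -- one Darboux step with parameter `ξ = a + i b` from an arbitrary solution `ũ`
    (∀ (ut : ℝ → ℝ → ℂ) (f : ℝ → ℝ → Fin 2 → ℂ),
      NLSBoundary.IsNLSSolution ut →
      NLSBoundary.IsLaxSolution ut ξ f →
      (∀ x t, f x t ≠ 0) →
        NLSBoundary.IsNLSSolution (NLSBoundary.darbouxPotential ξ ut f) ∧
        (∀ (l : ℂ) (φ : ℝ → ℝ → Fin 2 → ℂ), NLSBoundary.IsLaxSolution ut l φ →
          NLSBoundary.IsLaxSolution (NLSBoundary.darbouxPotential ξ ut f) l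
            (fun x t => Matrix.mulVec (NLSBoundary.darbouxMatrix ξ (f x t) l) (φ x t))) ∧
        NLSBoundary.IsRootBranch b (NLSBoundary.darbouxPotential ξ ut f) ut f
          (NLSBoundary.darbouxOmega b f) ∧
        NLSBoundary.IsBacklundPair a (NLSBoundary.darbouxPotential ξ ut f) ut
          (NLSBoundary.darbouxOmega b f) ∧
        (NLSBoundary.IsDirichlet ut →
          NLSBoundary.SatisfiesBoundaryCondition a b
            (NLSBoundary.darbouxPotential ξ ut f) f)) ∧
    -- the `N`-soliton solution with Dirichlet condition and the `(N+1)`-soliton solution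
    (∀ (N : ℕ) (κ c d : ℕ → ℂ), NLSBoundary.AdmissibleData N κ c d →
      (∀ x t, (NLSBoundary.delta1Matrix N κ c d x t).det ≠ 0) ∧
      (∀ m < 2 * N, ∀ x t, NLSBoundary.chainVec κ c d m x t ≠ 0) ∧
      NLSBoundary.IsNLSSolution (NLSBoundary.solitonPotential N κ c d) ∧
      NLSBoundary.IsDirichlet (NLSBoundary.solitonPotential N κ c d) ∧
      (∀ A B l : ℂ, NLSBoundary.IsLaxSolution (NLSBoundary.solitonPotential N κ c d) l
        (NLSBoundary.solitonLax N κ c d A B l)) ∧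
      (∀ A B : ℂ, (A ≠ 0 ∨ B ≠ 0) →
        (∀ k < 2 * N, ξ ≠ NLSBoundary.lam κ k) →
        (∀ k < 2 * N, ξ = (starRingEnd ℂ) (NLSBoundary.lam κ k) →
          A * (starRingEnd ℂ) (c (k / 2)) + B * (starRingEnd ℂ) (d (k / 2)) ≠ 0) →
          (∀ x t, NLSBoundary.solitonLax N κ c d A B ξ x t ≠ 0) ∧
          NLSBoundary.IsNLSSolution (NLSBoundary.boundarySoliton N κ c d A B ξ) ∧
          (∀ l A' B' : ℂ, NLSBoundary.IsLaxSolution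
            (NLSBoundary.boundarySoliton N κ c d A B ξ) l
            (fun x t => Matrix.mulVec
              (NLSBoundary.darbouxMatrix ξ (NLSBoundary.solitonLax N κ c d A B ξ x t) l)
              (NLSBoundary.solitonLax N κ c d A' B' l x t))) ∧
          NLSBoundary.IsRootBranch b (NLSBoundary.boundarySoliton N κ c d A B ξ)
            (NLSBoundary.solitonPotential N κ c d) (NLSBoundary.solitonLax N κ c d A B ξ)
            (NLSBoundary.darbouxOmega b (NLSBoundary.solitonLax N κ c d A B ξ)) ∧
          NLSBoundary.IsBacklundPair a (NLSBoundary.boundarySoliton N κ c d A B ξ)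
            (NLSBoundary.solitonPotential N κ c d)
            (NLSBoundary.darbouxOmega b (NLSBoundary.solitonLax N κ c d A B ξ)) ∧
          NLSBoundary.SatisfiesBoundaryCondition a b
            (NLSBoundary.boundarySoliton N κ c d A B ξ)
            (NLSBoundary.solitonLax N κ c d A B ξ))) ∧
    -- the case `N = 0`: the explicit one-soliton solution
    (∀ (κ c d : ℕ → ℂ) (A B : ℂ) (θ₁ θ₂ : ℝ), A ≠ 0 → B ≠ 0 →
      Complex.exp (Complex.I * (θ₁ : ℂ)) = A * (starRingEnd ℂ) B / ((‖A‖ : ℂ) * (‖B‖ : ℂ)) →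
      Real.exp θ₂ = ‖A / B‖ →
      ∀ x t : ℝ,
        NLSBoundary.boundarySoliton 0 κ c d A B ξ x t
          = 4 * (b : ℂ) * (NLSBoundary.freeLax A B ξ x t 0 *
              (starRingEnd ℂ) (NLSBoundary.freeLax A B ξ x t 1) /
              (NLSBoundary.normSq₂ (NLSBoundary.freeLax A B ξ x t) : ℂ)) ∧
        NLSBoundary.boundarySoliton 0 κ c d A B ξ x t
          = 2 * (b : ℂ) * Complex.exp (-2 * Complex.I * a * x
              - 4 * Complex.I * ((a : ℂ) ^ 2 - (b : ℂ) ^ 2) * t + Complex.I * θ₁) /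
            (Real.cosh (2 * b * x + 8 * a * b * t + θ₂) : ℂ)) := by
  refine ⟨fun ut f hut hL hf => ⟨NLSBoundary.isNLSSolution_darbouxPotential hξ hut hL hf,
    fun l φ hφ => NLSBoundary.isLaxSolution_darbouxMatrix_mulVec hξ hut hL hf hφ,
    NLSBoundary.isRootBranch_darbouxOmega hξ ut hL.1 hf,
    NLSBoundary.isBacklundPair_darbouxPotential hξ hut.1 hL hf,
    NLSBoundary.satisfiesBoundaryCondition_darbouxPotential hξ hut.1 hL hf⟩,
    fun N κ c d h => ?_, fun κ c d A B θ₁ θ₂ hA hB h1 h2 x t => ⟨?_, ?_⟩⟩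
  · obtain ⟨hN, hL⟩ := NLSBoundary.chainPotential_isSolution (κ := κ) (c := c) (d := d)
      (fun x t => NLSBoundary.chainVec_ne_zero h x t)
    -- The solution properties are proved for the iterated potential and carried over to the
    -- determinant quotient; the last soliton step is then one more Darboux step with `f` the
    -- transformed free solution at ξ.
    rw [NLSBoundary.chainPotential_eq_solitonPotential h] at hN hL
    have hD := NLSBoundary.isDirichlet_solitonPotential h
    refine ⟨NLSBoundary.det_delta1Matrix_ne_zero h,
      fun m hm x t => NLSBoundary.chainVec_ne_zero h x t m hm, hN, hD, hL,
      fun A B hAB hk hk' => ?_⟩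
    have hf := NLSBoundary.solitonLax_ne_zero h hAB hk hk'
    have hLξ : NLSBoundary.IsLaxSolution (NLSBoundary.solitonPotential N κ c d) ξ
      (NLSBoundary.solitonLax N κ c d A B ξ) := hL A B ξ
    exact ⟨hf, NLSBoundary.isNLSSolution_darbouxPotential hξ hN hLξ hf,
      fun l A' B' => NLSBoundary.isLaxSolution_darbouxMatrix_mulVec hξ hN hLξ hf (hL A' B' l),
      NLSBoundary.isRootBranch_darbouxOmega hξ _ hLξ.1 hf,
      NLSBoundary.isBacklundPair_darbouxPotential hξ hN.1 hLξ hf,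
      NLSBoundary.satisfiesBoundaryCondition_darbouxPotential hξ hN.1 hLξ hf hD⟩
  · exact NLSBoundary.boundarySoliton_zero hξ κ c d A B x t
  · exact NLSBoundary.boundarySoliton_zero_eq_cosh hξ κ c d hA hB h1 h2 x t
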